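/- **Setting.** For a security parameter $n$ let $\ell=\ell(n)$, $q_{\mathcal D}=q_{\mathcal D}(n)$, $q_{\tilde H}=q_{\tilde H}(n)$ be natural numbers bounded by polynomials in $n$, with $\ell>n+4$, and let $\epsilon=\epsilon(n)$ be a negligible function. Let $h_*=(h_0,\dots,h_\ell)$ be a family of independent uniformly random functions $h_0:\{0,1\}^{3n}\to\{0,1\}^n$ and $h_i:\{0,1\}^n\to\{0,1\}^{3n}$ for $1\le i\le\ell$, and let $R=(r_1,\dots,r_\ell)$ be uniform in $(\{0,1\}^n)^\ell$ and independent of $h_*$. A *subversion algorithm* $\tilde H$ is a deterministic algorithm, fixed independently of $h_*$ and $R$, which on input $(i,x)$ makes at most $q_{\tilde H}$ adaptive oracle queries to $h_*$ and outputs a value $\tilde h_i(x)$, such that for every $h_*$ and every $i\in\{0,\dots,\ell\}$, $\Pr_x[\tilde h_i(x)\ne h_i(x)]\le\epsilon(n)$, with $x$ uniform in the domain of $h_i$. Put $\tilde g_R(x)=\bigoplus_{i=1}^{\ell}\tilde h_i(x\oplus r_i)$. The *constellation* of $x\in\{0,1\}^n$ is the set of points $(i,x\oplus r_i)$, $0<i\le\ell$.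 **The game.** A distinguisher $\mathcal D$ (computationally unbounded, possibly with random coins independent of $R$ and $h_*$) is given $R$ and makes at most $q_{\mathcal D}$ adaptive queries, each either to $F$ at some $x\in\{0,1\}^n$ or to some $h_i$. The game keeps tables $T_F$ and $T_H$ of the values of $F$ and $h_*$, initially empty. Whenever a value of some $h_i$ is needed it is read from $T_H$; if it is unassigned, it is first assigned a fresh uniform value there. *Completing* the constellation of $x$ means assigning all $h_i(x\oplus r_i)$, $0<i\le\ell$, and then evaluating $\tilde H$ at all these points, its oracle queries being answered from $T_H$ in the same way; this determines $\tilde g_R(x)$. * A query for $h_0(y)$ is answered by its value. * On a query for $h_i(z)$ with $i>0$ its value is returned, and in addition, for $x=z\oplus r_i$, the constellation of $x$ is completed, $h_0(\tilde g_R(x))$ is evaluated, and $F(x)$ is set to it in $T_F$ unless $F(x)$ is already recorded. * A query for $F(x)$ is answered from $T_F$ if $F(x)$ is recorded there; otherwise the constellation of $x$ is completed, $h_0(\tilde g_R(x))$ is evaluated, recorded as $F(x)$ and returned. $\mathcal D$ *queries the constellation of $x$* when it queries $h_i(x\oplus r_i)$ for some $i>0$ or queries $F(x)$. Let $\mathrm{PRED}$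 be the event that, for some $x$, at the moment when $\mathcal D$ queries the constellation of $x$ for the first time (before that query is processed), $h_0(\tilde g_R(x))$ has already been assigned a value in $T_H$; here $\tilde g_R(x)$ is the value determined by the completion of the constellation. **Theorem.** $$\Pr[\mathrm{PRED}]=O\!\left(\ell^2q_{\mathcal D}^2q_{\tilde H}2^{-3n}+\sqrt{\ell}\,q_{\mathcal D}\,\epsilon^{1/16}\right).$$ Explicitly, there is an absolute constant $C>0$ such that for all functions $\ell,q_{\mathcal D},q_{\tilde H},\epsilon$ of $n$ as above there is an $n_0$ such that, for all $n\ge n_0$, all such $\tilde H$ and all such $\mathcal D$, $$\Pr[\mathrm{PRED}]\le C\left(\ell^2q_{\mathcal D}^2q_{\tilde H}2^{-3n}+\sqrt{\ell}\,q_{\mathcal D}\,\epsilon^{1/16}\right).$$ -/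

import Mathlib

namespace Crooked

/-- Bit strings of length `n`, as the group `(ℤ/2)^n`; addition is bitwise XOR. -/
abbrev Bits (n : ℕ) : Type := Fin n → ZMod 2

/-- The probability of `E` under a uniformly random element of the finite type `Ω`. -/
noncomputable def uniformProb (Ω : Type) [Fintype Ω] (E : Ω → Prop) : ℝ :=
  open Classical in ((Finset.univ.filter E).card : ℝ) / (Fintype.card Ω : ℝ)

/-- A sequence of natural numbers bounded by a polynomial. -/
def PolyBounded (q : ℕ → ℕ) : Prop :=
  ∃ p : Polynomial ℕ, ∀ n, q n ≤ p.eval n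

/-! ### Deterministic oracle algorithms -/

/-- A deterministic algorithm with adaptive oracle queries `q : Q`, answered in `A q`, and with
output in `α` (computationally unbounded; only its queries are counted). -/
inductive OracleAlg (Q : Type) (A : Q → Type) (α : Type) : Type
  | ret (a : α) : OracleAlg Q A α
  | ask (q : Q) (k : A q → OracleAlg Q A α) : OracleAlg Q A α

/-- The output of the algorithm with the oracle `O`. -/
def OracleAlg.run {Q : Type} {A : Q → Type} {α : Type} (O : (q : Q) → A q) :
    OracleAlg Q A α → α
  | .ret a => a
  | .ask q k => OracleAlg.run O (k (O q))

/-- The queries, in order, that the algorithm makes to the oracle `O`. -/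
def OracleAlg.queries {Q : Type} {A : Q → Type} {α : Type} (O : (q : Q) → A q) :
    OracleAlg Q A α → List Q
  | .ret _ => []
  | .ask q k => q :: OracleAlg.queries O (k (O q))

/-- Whatever the oracle, the algorithm makes at most `m` queries. -/
def OracleAlg.QueryBound {Q : Type} {A : Q → Type} {α : Type} (M : OracleAlg Q A α) (m : ℕ) :
    Prop :=
  ∀ O : (q : Q) → A q, (M.queries O).length ≤ m

/-! ### The source functions, and subversion -/

/-- Points of the domain of the family `h_0, h_1, …, h_ℓ`: `.inl y` is the input `y` of `h_0`, and
`.inr (i, x)` is the input `x` of `h_{i+1}` (the indices `1, …, ℓ` are `Fin ℓ`). -/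
abbrev Point (n ℓ : ℕ) : Type := Bits (3 * n) ⊕ (Fin ℓ × Bits n)

/-- `h_0` takes values in `n`-bit strings, the other functions in `3n`-bit strings. -/
abbrev Val (n ℓ : ℕ) : Point n ℓ → Type
  | .inl _ => Bits n
  | .inr _ => Bits (3 * n)

instance instFintypeVal (n ℓ : ℕ) : (p : Point n ℓ) → Fintype (Val n ℓ p)
  | .inl _ => inferInstanceAs (Fintype (Bits n))
  | .inr _ => inferInstanceAs (Fintype (Bits (3 * n)))

/-- A family `h_* = (h_0, …, h_ℓ)` with `h_0 : {0,1}^{3n} → {0,1}^n` and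
`h_i : {0,1}^n → {0,1}^{3n}` for `i > 0`. -/
abbrev HashFamily (n ℓ : ℕ) : Type := (p : Point n ℓ) → Val n ℓ p

/-- A subversion algorithm: on an input point, an algorithm with oracle access to `h_*` that outputs
the subverted value at that point. -/
abbrev Subversion (n ℓ : ℕ) : Type :=
  (p : Point n ℓ) → OracleAlg (Point n ℓ) (Val n ℓ) (Val n ℓ p)

/-- For every `h_*` and every index `i`, the subverted function differs from `h_i` with
probability at most `ε` at a uniformly random input of `h_i`. -/
def Subversion.DisagreementAtMost {n ℓ : ℕ} (Ht : Subversion n ℓ) (ε : ℝ) : Prop :=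
  ∀ h : HashFamily n ℓ,
    uniformProb (Bits (3 * n)) (fun y => (Ht (.inl y)).run h ≠ h (.inl y)) ≤ ε ∧
    ∀ i : Fin ℓ,
      uniformProb (Bits n) (fun x => (Ht (.inr (i, x))).run h ≠ h (.inr (i, x))) ≤ ε

/-! ### Lazily filled tables -/

/-- A table of the values of `h_*` that have been assigned so far. -/
abbrev Table (n ℓ : ℕ) : Type := (p : Point n ℓ) → Option (Val n ℓ p)

/-- Look up `p` in the table; if it is unassigned, assign to it a fresh random value first. The
fresh value for the point `p` is the entry `h p` of a uniformly random family `h`; it is drawn at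
most once in a game, since it is recorded. -/
def lookup {n ℓ : ℕ} (h : HashFamily n ℓ) (T : Table n ℓ) (p : Point n ℓ) :
    Val n ℓ p × Table n ℓ :=
  match T p with
  | some v => (v, T)
  | none => (h p, Function.update T p (some (h p)))

/-- Run an algorithm, answering its queries from the table. -/
def evalLazy {n ℓ : ℕ} {α : Type} (h : HashFamily n ℓ) :
    OracleAlg (Point n ℓ) (Val n ℓ) α → Table n ℓ → α × Table n ℓ
  | .ret a, T => (a, T)
  | .ask q k, T => evalLazy h (k (lookup h T q).1) (lookup h T q).2

/-- Completing the constellation `{(i, x ⊕ r_i) : 0 < i ≤ ℓ}` of `x`: first all values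
`h_i(x ⊕ r_i)` are assigned, then the subversion algorithm is evaluated at all these points.
Returns the XOR `g̃_R(x)` of the subverted values, and the new table. -/
def complete {n ℓ : ℕ} (Ht : Subversion n ℓ) (R : Fin ℓ → Bits n) (h : HashFamily n ℓ)
    (x : Bits n) (T : Table n ℓ) : Bits (3 * n) × Table n ℓ :=
  let T₁ : Table n ℓ :=
    (List.finRange ℓ).foldl (fun T i => (lookup h T (.inr (i, x + R i))).2) T
  (List.finRange ℓ).foldl
    (fun (a : Bits (3 * n) × Table n ℓ) i =>
      let r := evalLazy h (Ht (.inr (i, x + R i))) a.2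
      (a.1 + r.1, r.2))
    (0, T₁)

/-! ### The game -/

/-- Queries of the distinguisher: `.inl x` asks for `F(x)` (the construction), and `.inr p` asks for
the value of `h_*` at `p`. -/
abbrev DQuery (n ℓ : ℕ) : Type := Bits n ⊕ Point n ℓ

/-- Types of the answers to the distinguisher. -/
abbrev DAns (n ℓ : ℕ) : DQuery n ℓ → Type
  | .inl _ => Bits n
  | .inr p => Val n ℓ p

/-- A deterministic distinguisher; it receives the public randomness `R = (r_1, …, r_ℓ)` and
returns a decision bit. -/
abbrev Distinguisher (n ℓ : ℕ) : Type :=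
  (Fin ℓ → Bits n) → OracleAlg (DQuery n ℓ) (DAns n ℓ) Bool

/-- The tables `T_F` and `T_H` of the game. -/
structure GameState (n ℓ : ℕ) : Type where
  TF : Bits n → Option (Bits n)
  TH : Table n ℓ

/-- All tables empty. -/
def GameState.initial (n ℓ : ℕ) : GameState n ℓ := ⟨fun _ => none, fun _ => none⟩

/-- The rules of the game "construction with unsubverted `h_0`", in its lazy form.
* `F(x)`: if recorded in `T_F`, it is returned; otherwise the constellation of `x` is completed,
  `h_0(g̃_R(x))` is looked up, recorded as `F(x)` and returned.
* `h_0(y)`: looked up in `T_H`.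
* `h_i(z)`, `i > 0`: looked up in `T_H`; moreover the constellation of `x = z ⊕ r_i` is completed,
  `h_0(g̃_R(x))` is looked up, and recorded as `F(x)` if `F(x)` is unassigned. -/
def answer {n ℓ : ℕ} (Ht : Subversion n ℓ) (R : Fin ℓ → Bits n) (h : HashFamily n ℓ) :
    (q : DQuery n ℓ) → GameState n ℓ → DAns n ℓ q × GameState n ℓ
  | .inl x, s =>
    match s.TF x with
    | some v => (v, s)
    | none =>
      let c := complete Ht R h x s.TH
      let r := lookup h c.2 (.inl c.1)
      (r.1, ⟨Function.update s.TF x (some r.1), r.2⟩)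
  | .inr (.inl y), s =>
    let r := lookup h s.TH (.inl y)
    (r.1, ⟨s.TF, r.2⟩)
  | .inr (.inr (i, z)), s =>
    let a := lookup h s.TH (.inr (i, z))
    let c := complete Ht R h (z + R i) a.2
    let r := lookup h c.2 (.inl c.1)
    (a.1, ⟨if (s.TF (z + R i)).isSome then s.TF
      else Function.update s.TF (z + R i) (some r.1), r.2⟩)

/-- The interaction: the list of the distinguisher's queries in order, each with the state of the
tables just before that query is answered. -/
def trace {n ℓ : ℕ} (Ht : Subversion n ℓ) (R : Fin ℓ → Bits n) (h : HashFamily n ℓ) :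
    OracleAlg (DQuery n ℓ) (DAns n ℓ) Bool → GameState n ℓ →
      List (GameState n ℓ × DQuery n ℓ)
  | .ret _, _ => []
  | .ask q k, s =>
    (s, q) :: trace Ht R h (k (answer Ht R h q s).1) (answer Ht R h q s).2

/-- The query addresses the constellation of `x`: it asks for some `h_i(x ⊕ r_i)` with `i > 0`, or
for `F(x)` (these are the queries upon which the game completes the constellation of `x`). -/
def Touches {n ℓ : ℕ} (R : Fin ℓ → Bits n) (q : DQuery n ℓ) (x : Bits n) : Prop :=
  q = .inl x ∨ ∃ i : Fin ℓ, q = .inr (.inr (i, x + R i))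

/-- The crisis event `PRED`: for some `x`, a query of the distinguisher addresses the constellation
of `x` for the first time, and at that moment (before the query is answered) `h_0(g̃_R(x))` is
already assigned in `T_H`; here `g̃_R(x)` is the value determined by the completion of the
constellation. -/
def Pred {n ℓ : ℕ} (Ht : Subversion n ℓ) (D : Distinguisher n ℓ) (R : Fin ℓ → Bits n)
    (h : HashFamily n ℓ) : Prop :=
  ∃ (x : Bits n) (before after : List (GameState n ℓ × DQuery n ℓ)) (s : GameState n ℓ)
    (q : DQuery n ℓ),
    trace Ht R h (D R) (GameState.initial n ℓ) = before ++ (s, q) :: after ∧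
    Touches R q x ∧ (∀ e ∈ before, ¬ Touches R e.2 x) ∧
    (s.TH (.inl (complete Ht R h x s.TH).1)).isSome

/-- The probability of `PRED` over the coins `u` of the distinguisher, the public randomness `R`
and the random family `h_*`, all uniform and independent. -/
noncomputable def predProb {n ℓ : ℕ} (U : Type) [Fintype U] (Ht : Subversion n ℓ)
    (D : U → Distinguisher n ℓ) : ℝ :=
  uniformProb (U × (Fin ℓ → Bits n) × HashFamily n ℓ) (fun ω => Pred Ht (D ω.1) ω.2.1 ω.2.2)

end Crooked

/-! Every lazily assigned value is an entry of one random family `h`, so the game is a deterministic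
run against `h`. PRED then gives a `Hit`: query t is the first to address the constellation of x,
and g̃_R(x) is an input of `h_0` contributed by an earlier query t' through a source σ. With d and m
the query bounds of distinguisher and subversion, there are at most d²(ℓm + 1) triples (t, t', σ).
For each, `card_hit_mul_le` bounds the share of families that are `Typical` and hit by 4·2^(-3n).

The reason is that g̃_R(x) can be re-randomised. Suppose q = (j, x + r_j) is leaked neither in `h`
nor after its value is resampled to v. Then every other point whose run asks for q is honest in both
families. So g̃_R is unchanged away from x, the first t queries and their answers survive, and
g̃_R(x) is translated by v - h(q). If the single run behind σ does not ask for q, the source still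
holds the old g̃_R(x). Hence for fixed j the resampled family determines x, v, the old g̃_R(x), and
thus h(q): the map (h, v) ↦ h' is injective. With half of the j and half of the v usable, counting
triples (h, j, v) gives the bound.

It remains to see that atypical pairs (R, h) are rare. Small disagreement leaves few leaked points
in each family. Resampling preserves the uniform measure, so Markov's inequality shows that for most
families few points are `Bad`. These sets depend on `h` only, so the independent shifts R put over
half of a constellation into them with probability exponentially small in ℓ. Since ℓ > n + 4, this
survives the union bound over all x and all runs. -/

namespace Crooked

/-! ### Oracle algorithms depend only on the answers to their queries -/

theorem OracleAlg.run_queries_congr {Q : Type} {A : Q → Type} {α : Type} {O O' : (q : Q) → A q} :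
    ∀ M : OracleAlg Q A α, (∀ q ∈ M.queries O, O' q = O q) →
      M.run O' = M.run O ∧ M.queries O' = M.queries O
  | .ret _, _ => ⟨rfl, rfl⟩
  | .ask q k, h => by
    have hq : O' q = O q := h q (by simp [OracleAlg.queries])
    have ih := OracleAlg.run_queries_congr (O := O) (O' := O') (k (O q))
      (fun q' hq' => h q' (by simp [OracleAlg.queries, hq']))
    simp only [OracleAlg.run, OracleAlg.queries, hq, ih, and_self]

/-- The first t answers already fix the query after them, whatever its own answer is; hence the
shift from t to t + 1. -/
theorem OracleAlg.take_queries_congr {Q : Type} {A : Q → Type} {α : Type}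
    {O O' : (q : Q) → A q} :
    ∀ (M : OracleAlg Q A α) (t : ℕ), (∀ q ∈ (M.queries O).take t, O' q = O q) →
      (M.queries O').take (t + 1) = (M.queries O).take (t + 1)
  | .ret _, _, _ => rfl
  | .ask q k, 0, _ => by simp [OracleAlg.queries]
  | .ask q k, t + 1, h => by
    have hq : O' q = O q := h q (by simp [OracleAlg.queries])
    have ih := OracleAlg.take_queries_congr (O := O) (O' := O') (k (O q)) t
      (fun q' hq' => h q' (by simp [OracleAlg.queries, hq']))
    simp only [OracleAlg.queries, hq, List.take_succ_cons] at ih ⊢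
    rw [ih]

variable {n ℓ : ℕ}

/-! ### The lazily filled tables agree with the underlying family -/

/-- All assigned entries of the table are values of `h`. -/
def Table.Consistent (h : HashFamily n ℓ) (T : Table n ℓ) : Prop :=
  ∀ p v, T p = some v → v = h p

theorem lookup_fst {h : HashFamily n ℓ} {T : Table n ℓ} (hT : T.Consistent h) (p : Point n ℓ) :
    (lookup h T p).1 = h p := by
  unfold lookup
  split
  · exact hT _ _ (by assumption)
  · rfl

theorem lookup_consistent {h : HashFamily n ℓ} {T : Table n ℓ} (hT : T.Consistent h)
    (p : Point n ℓ) : Table.Consistent h (lookup h T p).2 := by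
  unfold lookup
  split
  · exact hT
  · intro p' v hv
    by_cases hp : p' = p
    · subst hp
      simpa using hv.symm
    · exact hT p' v (by simpa [hp] using hv)

theorem isSome_lookup {h : HashFamily n ℓ} {T : Table n ℓ} {p q : Point n ℓ}
    (hq : ((lookup h T p).2 q).isSome) : (T q).isSome ∨ q = p := by
  unfold lookup at hq
  split at hq
  · exact .inl hq
  · by_cases hp : q = p
    · exact .inr hp
    · exact .inl (by simpa [hp] using hq)

theorem evalLazy_spec {α : Type} {h : HashFamily n ℓ} :
    ∀ (M : OracleAlg (Point n ℓ) (Val n ℓ) α) {T : Table n ℓ}, T.Consistent h →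
      (evalLazy h M T).1 = M.run h ∧ Table.Consistent h (evalLazy h M T).2 ∧
      ∀ q, ((evalLazy h M T).2 q).isSome → (T q).isSome ∨ q ∈ M.queries h
  | .ret _, _, hT => ⟨rfl, hT, fun _ hq => .inl hq⟩
  | .ask q k, T, hT => by
    obtain ⟨h1, h2, h3⟩ := evalLazy_spec (k (lookup h T q).1) (lookup_consistent hT q)
    rw [lookup_fst hT] at h1 h2 h3
    refine ⟨?_, ?_, ?_⟩
    · simpa only [evalLazy, OracleAlg.run, lookup_fst hT] using h1
    · simpa only [evalLazy, lookup_fst hT] using h2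
    · intro p hp
      simp only [evalLazy, lookup_fst hT] at hp
      rcases h3 p hp with hp | hp
      · rcases isSome_lookup hp with hp | hp
        · exact .inl hp
        · exact .inr (by simp [OracleAlg.queries, hp])
      · exact .inr (by simp [OracleAlg.queries, hp])

/-- The value `g̃_R(x)` computed directly from the family `h`. -/
def gTilde (Ht : Subversion n ℓ) (R : Fin ℓ → Bits n) (h : HashFamily n ℓ) (x : Bits n) :
    Bits (3 * n) :=
  ∑ i : Fin ℓ, ((Ht (.inr (i, x + R i))).run h : Bits (3 * n))

theorem foldl_lookup_spec {h : HashFamily n ℓ} (f : Fin ℓ → Fin ℓ × Bits n) :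
    ∀ (L : List (Fin ℓ)) {T : Table n ℓ}, T.Consistent h →
      Table.Consistent h (L.foldl (fun T i => (lookup h T (.inr (f i))).2) T) ∧
      ∀ y, ((L.foldl (fun T i => (lookup h T (.inr (f i))).2) T) (.inl y)).isSome →
        (T (.inl y)).isSome
  | [], _, hT => ⟨hT, fun _ hy => hy⟩
  | i :: L, T, hT => by
    obtain ⟨h1, h2⟩ := foldl_lookup_spec f L (lookup_consistent hT (.inr (f i)))
    refine ⟨h1, fun y hy => ?_⟩
    rcases isSome_lookup (h2 y hy) with hy | hy
    · exact hy
    · cases hy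

theorem foldl_evalLazy_spec {Ht : Subversion n ℓ} {h : HashFamily n ℓ}
    (f : Fin ℓ → Fin ℓ × Bits n) :
    ∀ (L : List (Fin ℓ)) (a : Bits (3 * n) × Table n ℓ), Table.Consistent h a.2 →
      let b := L.foldl (fun (a : Bits (3 * n) × Table n ℓ) i =>
        let r := evalLazy h (Ht (.inr (f i))) a.2
        (a.1 + r.1, r.2)) a
      b.1 = a.1 + (L.map fun i => ((Ht (.inr (f i))).run h : Bits (3 * n))).sum ∧
      Table.Consistent h b.2 ∧
      ∀ q, (b.2 q).isSome → (a.2 q).isSome ∨ ∃ i, q ∈ (Ht (.inr (f i))).queries h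
  | [], a, ha => ⟨by simp, ha, fun _ hq => .inl hq⟩
  | i :: L, a, ha => by
    obtain ⟨e1, e2, e3⟩ := evalLazy_spec (Ht (.inr (f i))) ha
    obtain ⟨h1, h2, h3⟩ := foldl_evalLazy_spec (Ht := Ht) f L
      (a.1 + (evalLazy h (Ht (.inr (f i))) a.2).1, (evalLazy h (Ht (.inr (f i))) a.2).2) e2
    refine ⟨?_, h2, fun q hq => ?_⟩
    · rw [List.foldl_cons, List.map_cons, List.sum_cons, ← add_assoc]
      rw [e1] at h1
      rw [← h1]
      simp only [e1]
    · rcases h3 q hq with hq | hq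
      · rcases e3 q hq with hq | hq
        · exact .inl hq
        · exact .inr ⟨i, hq⟩
      · exact .inr hq

theorem complete_spec {Ht : Subversion n ℓ} {R : Fin ℓ → Bits n} {h : HashFamily n ℓ}
    (x : Bits n) {T : Table n ℓ} (hT : T.Consistent h) :
    (complete Ht R h x T).1 = gTilde Ht R h x ∧
    Table.Consistent h (complete Ht R h x T).2 ∧
    ∀ y, ((complete Ht R h x T).2 (.inl y)).isSome →
      (T (.inl y)).isSome ∨ ∃ i, .inl y ∈ (Ht (.inr (i, x + R i))).queries h := by
  obtain ⟨h1, h2⟩ := foldl_lookup_spec (fun i => (i, x + R i)) (List.finRange ℓ) hT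
  obtain ⟨e1, e2, e3⟩ := foldl_evalLazy_spec (Ht := Ht) (fun i => (i, x + R i))
    (List.finRange ℓ) (0, _) h1
  refine ⟨?_, e2, fun y hy => ?_⟩
  · refine e1.trans ?_
    rw [zero_add, gTilde, ← List.sum_toFinset _ (List.nodup_finRange ℓ)]
    simp
  · rcases e3 _ hy with hy | hy
    · exact .inl (h2 y hy)
    · exact .inr hy

/-! ### The game in terms of the underlying family -/

/-- The answers of the game, computed directly from the family `h`. -/
def eagerAnswer (Ht : Subversion n ℓ) (R : Fin ℓ → Bits n) (h : HashFamily n ℓ) :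
    (q : DQuery n ℓ) → DAns n ℓ q
  | .inl x => h (.inl (gTilde Ht R h x))
  | .inr p => h p

/-- The point whose constellation is addressed by a query. -/
def touched (R : Fin ℓ → Bits n) : DQuery n ℓ → Option (Bits n)
  | .inl x => some x
  | .inr (.inl _) => none
  | .inr (.inr (i, z)) => some (z + R i)

theorem Bits.add_cancel {m : ℕ} (a b : Bits m) : a + b + b = a := by
  funext i
  simp [add_assoc, CharTwo.add_self_eq_zero]

theorem touches_iff {R : Fin ℓ → Bits n} {q : DQuery n ℓ} {x : Bits n} :
    Touches R q x ↔ touched R q = some x := by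
  rcases q with x' | y | ⟨i, z⟩
  · simp [Touches, touched]
  · simp [Touches, touched]
  · simp only [Touches, touched, Option.some.injEq, reduceCtorEq, false_or, Sum.inr.injEq,
      Prod.mk.injEq]
    constructor
    · rintro ⟨j, rfl, rfl⟩
      exact Bits.add_cancel _ _
    · rintro rfl
      exact ⟨i, rfl, (Bits.add_cancel _ _).symm⟩

/-- The inputs of `h_0` that are assigned while the query is processed. -/
def Assigns (Ht : Subversion n ℓ) (R : Fin ℓ → Bits n) (h : HashFamily n ℓ) (q : DQuery n ℓ)
    (y : Bits (3 * n)) : Prop :=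
  q = .inr (.inl y) ∨ ∃ x, touched R q = some x ∧
    (y = gTilde Ht R h x ∨ ∃ i, .inl y ∈ (Ht (.inr (i, x + R i))).queries h)

/-- The tables hold values determined by `h`. -/
def GameState.Consistent (Ht : Subversion n ℓ) (R : Fin ℓ → Bits n) (h : HashFamily n ℓ)
    (s : GameState n ℓ) : Prop :=
  Table.Consistent h s.TH ∧ ∀ x v, s.TF x = some v → v = h (.inl (gTilde Ht R h x))

theorem complete_lookup_spec {Ht : Subversion n ℓ} {R : Fin ℓ → Bits n} {h : HashFamily n ℓ}
    (x : Bits n) {T : Table n ℓ} (hT : T.Consistent h) :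
    let c := complete Ht R h x T
    let r := lookup h c.2 (.inl c.1)
    r.1 = h (.inl (gTilde Ht R h x)) ∧ Table.Consistent h r.2 ∧
    ∀ y, (r.2 (.inl y)).isSome → (T (.inl y)).isSome ∨
      (y = gTilde Ht R h x ∨ ∃ i, .inl y ∈ (Ht (.inr (i, x + R i))).queries h) := by
  obtain ⟨h1, h2, h3⟩ := complete_spec (Ht := Ht) (R := R) x hT
  refine ⟨?_, lookup_consistent h2 _, fun y hy => ?_⟩
  · rw [lookup_fst h2, h1]
  · rcases isSome_lookup hy with hy | hy
    · rcases h3 y hy with hy | hy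
      · exact .inl hy
      · exact .inr (.inr hy)
    · rw [h1] at hy
      exact .inr (.inl (Sum.inl.inj hy))

theorem answer_spec {Ht : Subversion n ℓ} {R : Fin ℓ → Bits n} {h : HashFamily n ℓ}
    (q : DQuery n ℓ) {s : GameState n ℓ} (hs : s.Consistent Ht R h) :
    (answer Ht R h q s).1 = eagerAnswer Ht R h q ∧
    (answer Ht R h q s).2.Consistent Ht R h ∧
    ∀ y, ((answer Ht R h q s).2.TH (.inl y)).isSome →
      (s.TH (.inl y)).isSome ∨ Assigns Ht R h q y := by
  have upd : ∀ (x x' : Bits n) (v v' : Bits n), v' = h (.inl (gTilde Ht R h x)) →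
      Function.update s.TF x (some v') x' = some v → v = h (.inl (gTilde Ht R h x')) := by
    intro x x' v v' hv' hv
    by_cases hx : x' = x
    · subst hx
      simp only [Function.update_self, Option.some.injEq] at hv
      rw [← hv, hv']
    · exact hs.2 x' v (by simpa [hx] using hv)
  rcases q with x | y | ⟨i, z⟩
  · obtain ⟨h1, h2, h3⟩ := complete_lookup_spec (Ht := Ht) (R := R) x hs.1
    cases hx : s.TF x with
    | some v =>
      have e : answer Ht R h (.inl x) s = (v, s) := by simp only [answer, hx]
      rw [e]
      exact ⟨hs.2 x v hx, hs, fun y hy => .inl hy⟩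
    | none =>
      have e : answer Ht R h (.inl x) s =
          let c := complete Ht R h x s.TH
          let r := lookup h c.2 (.inl c.1)
          (r.1, ⟨Function.update s.TF x (some r.1), r.2⟩) := by simp only [answer, hx]
      rw [e]
      refine ⟨h1, ⟨h2, fun x' v hv => upd x x' v _ h1 hv⟩, fun y hy => ?_⟩
      rcases h3 y hy with hy | hy
      · exact .inl hy
      · exact .inr (.inr ⟨x, rfl, hy⟩)
  · refine ⟨lookup_fst hs.1 _, ⟨lookup_consistent hs.1 _, hs.2⟩, fun y' hy => ?_⟩
    rcases isSome_lookup hy with hy | hy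
    · exact .inl hy
    · cases hy
      exact .inr (.inl rfl)
  · obtain ⟨h1, h2, h3⟩ := complete_lookup_spec (Ht := Ht) (R := R) (z + R i)
      (lookup_consistent hs.1 (.inr (i, z)))
    refine ⟨lookup_fst hs.1 _, ⟨h2, fun x' v hv => ?_⟩, fun y hy => ?_⟩
    · simp only [answer] at hv
      split at hv
      · exact hs.2 x' v hv
      · exact upd _ x' v _ h1 hv
    · rcases h3 y hy with hy | hy
      · rcases isSome_lookup hy with hy | hy
        · exact .inl hy
        · cases hy
      · exact .inr (.inr ⟨_, rfl, hy⟩)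

/-- This removes the tables from the argument: the queries are those of a run against `eagerAnswer`,
and every assigned input of `h_0` is charged to an earlier query. -/
theorem trace_spec {Ht : Subversion n ℓ} {R : Fin ℓ → Bits n} {h : HashFamily n ℓ} :
    ∀ (M : OracleAlg (DQuery n ℓ) (DAns n ℓ) Bool) {s : GameState n ℓ}
      (before after : List (GameState n ℓ × DQuery n ℓ)) (s' : GameState n ℓ) (q : DQuery n ℓ),
      s.Consistent Ht R h → trace Ht R h M s = before ++ (s', q) :: after →
      s'.Consistent Ht R h ∧
      M.queries (eagerAnswer Ht R h) = before.map Prod.snd ++ q :: after.map Prod.snd ∧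
      ∀ y, (s'.TH (.inl y)).isSome → (s.TH (.inl y)).isSome ∨
        ∃ q' ∈ before.map Prod.snd, Assigns Ht R h q' y
  | .ret _, _, before, after, s', q, _, ht => by simp [trace] at ht
  | .ask q₀ k, s, before, after, s', q, hs, ht => by
    have hq : ∀ (M : OracleAlg (DQuery n ℓ) (DAns n ℓ) Bool) {s : GameState n ℓ},
        s.Consistent Ht R h →
        (trace Ht R h M s).map Prod.snd = M.queries (eagerAnswer Ht R h) := by
      intro M
      induction M with
      | ret => intro s _; rfl
      | ask q k ih =>
        intro s hs
        obtain ⟨a1, a2, -⟩ := answer_spec q hs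
        simp only [trace, OracleAlg.queries, List.map_cons, ih _ a2, a1]
    obtain ⟨a1, a2, a3⟩ := answer_spec q₀ hs
    rcases before with _ | ⟨e, before⟩
    · have hq' := hq (.ask q₀ k) hs
      rw [ht] at hq'
      simp only [trace, List.nil_append, List.cons.injEq, Prod.mk.injEq] at ht
      obtain ⟨⟨rfl, rfl⟩, -⟩ := ht
      exact ⟨hs, by simpa using hq'.symm, fun y hy => .inl hy⟩
    · have hq' := hq (.ask q₀ k) hs
      rw [ht] at hq'
      simp only [trace, List.cons_append, List.cons.injEq] at ht
      obtain ⟨rfl, ht⟩ := ht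
      obtain ⟨h1, -, h3⟩ := trace_spec _ before after s' q a2 ht
      refine ⟨h1, by simpa using hq'.symm, fun y hy => ?_⟩
      rcases h3 y hy with hy | ⟨q', hq'', hy⟩
      · rcases a3 y hy with hy | hy
        · exact .inl hy
        · exact .inr ⟨q₀, by simp, hy⟩
      · exact .inr ⟨q', by simp only [List.map_cons, List.mem_cons]; exact .inr hq'', hy⟩

/-- The input of `h_0` contributed by a query: the source `none` is the input asked for directly, or
`g̃_R(x)` for the constellation addressed; the source `some (i, k)` is the `k`-th query of the
subversion algorithm at the `i`-th point of the constellation addressed. -/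
def sourceValue {m : ℕ} (Ht : Subversion n ℓ) (R : Fin ℓ → Bits n) (h : HashFamily n ℓ)
    (q : DQuery n ℓ) : Option (Fin ℓ × Fin m) → Option (Bits (3 * n))
  | none =>
    match q with
    | .inr (.inl y) => some y
    | q => (touched R q).map (gTilde Ht R h)
  | some (i, k) => (touched R q).bind fun x =>
      (((Ht (.inr (i, x + R i))).queries h)[(k : ℕ)]?).bind Sum.getLeft?

theorem Assigns.exists_source {Ht : Subversion n ℓ} {R : Fin ℓ → Bits n} {h : HashFamily n ℓ}
    {m : ℕ} (hm : ∀ p, (Ht p).QueryBound m) {q : DQuery n ℓ} {y : Bits (3 * n)}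
    (hy : Assigns Ht R h q y) :
    ∃ σ : Option (Fin ℓ × Fin m), sourceValue Ht R h q σ = some y := by
  rcases hy with rfl | ⟨x, hx, rfl | ⟨i, hi⟩⟩
  · exact ⟨none, rfl⟩
  · refine ⟨none, ?_⟩
    rcases q with x' | y | ⟨i, z⟩
    · simpa [sourceValue, touched] using congrArg (Option.map (gTilde Ht R h)) hx
    · simp [touched] at hx
    · simpa [sourceValue, touched] using congrArg (Option.map (gTilde Ht R h)) hx
  · obtain ⟨k, hk, hki⟩ := List.getElem_of_mem hi
    refine ⟨some (i, ⟨k, hk.trans_le (hm _ h)⟩), ?_⟩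
    simp [sourceValue, hx, List.getElem?_eq_getElem hk, hki]

/-- The `t`-th query addresses the constellation of `x`, which no earlier query does. -/
def FirstTouch (Ht : Subversion n ℓ) (R : Fin ℓ → Bits n)
    (M : OracleAlg (DQuery n ℓ) (DAns n ℓ) Bool) (h : HashFamily n ℓ) (t : ℕ) (x : Bits n) :
    Prop :=
  ((M.queries (eagerAnswer Ht R h))[t]?).bind (touched R) = some x ∧
    ∀ q ∈ (M.queries (eagerAnswer Ht R h)).take t, touched R q ≠ some x

/-- The `t`-th query addresses a new constellation, that of `x`, and `g̃_R(x)` is the input of `h_0`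
contributed by the source `σ` of the `t'`-th query, which is earlier. -/
def Hit {m : ℕ} (Ht : Subversion n ℓ) (R : Fin ℓ → Bits n)
    (M : OracleAlg (DQuery n ℓ) (DAns n ℓ) Bool) (h : HashFamily n ℓ) (t t' : ℕ)
    (σ : Option (Fin ℓ × Fin m)) (x : Bits n) : Prop :=
  FirstTouch Ht R M h t x ∧ t' < t ∧
    ((M.queries (eagerAnswer Ht R h))[t']?).bind (fun q => sourceValue Ht R h q σ) =
      some (gTilde Ht R h x)

theorem Pred.exists_hit {Ht : Subversion n ℓ} {D : Distinguisher n ℓ} {R : Fin ℓ → Bits n}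
    {h : HashFamily n ℓ} {m d : ℕ} (hm : ∀ p, (Ht p).QueryBound m) (hd : (D R).QueryBound d)
    (hP : Pred Ht D R h) :
    ∃ (t t' : Fin d) (σ : Option (Fin ℓ × Fin m)), ∃ x, Hit Ht R (D R) h t t' σ x := by
  obtain ⟨x, before, after, s, q, ht, hqx, hb, hs⟩ := hP
  have h0 : (GameState.initial n ℓ).Consistent Ht R h :=
    ⟨fun p v hv => by simp [GameState.initial] at hv,
      fun p v hv => by simp [GameState.initial] at hv⟩
  obtain ⟨h1, h2, h3⟩ := trace_spec (D R) before after s q h0 ht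
  rw [(complete_spec x h1.1).1] at hs
  rcases h3 _ hs with hs | ⟨q', hq', hy⟩
  · simp [GameState.initial] at hs
  obtain ⟨σ, hσ⟩ := hy.exists_source hm
  obtain ⟨t', ht', htq'⟩ := List.getElem_of_mem hq'
  have hlen := hd (eagerAnswer Ht R h)
  rw [h2] at hlen
  simp only [List.length_append, List.length_map, List.length_cons] at hlen ht'
  refine ⟨⟨before.length, by omega⟩, ⟨t', by omega⟩, σ, x, ⟨?_, ?_⟩, by simpa using ht', ?_⟩
  · simp only [h2]
    rw [List.getElem?_append_right (by simp)]
    simpa using touches_iff.1 hqx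
  · intro e he
    rw [h2, List.take_left' (by simp)] at he
    obtain ⟨e', he', rfl⟩ := List.mem_map.1 he
    exact fun hx => hb e' he' (touches_iff.2 hx)
  · simp only [h2]
    rw [List.getElem?_append_left (by simpa using ht'), List.getElem?_eq_getElem (by simpa using ht'),
      htq']
    exact hσ

/-! ### Resampling one value -/

/-- The family with the value at the point `q` replaced by `v`. -/
def resample (h : HashFamily n ℓ) (q : Fin ℓ × Bits n) (v : Bits (3 * n)) : HashFamily n ℓ :=
  Function.update h (.inr q) v

theorem resample_self (h : HashFamily n ℓ) (q : Fin ℓ × Bits n) (v : Bits (3 * n)) :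
    resample h q v (.inr q) = v := Function.update_self ..

theorem resample_of_ne (h : HashFamily n ℓ) {q : Fin ℓ × Bits n} (v : Bits (3 * n))
    {p : Point n ℓ} (hp : p ≠ .inr q) : resample h q v p = h p := Function.update_of_ne hp ..

/-- The value at `q` may influence a subverted value: some point that is subverted is either `q` or
queries `q`. -/
def Leaked (Ht : Subversion n ℓ) (h : HashFamily n ℓ) (q : Fin ℓ × Bits n) : Prop :=
  ∃ p : Fin ℓ × Bits n, (Ht (.inr p)).run h ≠ h (.inr p) ∧
    (p = q ∨ .inr q ∈ (Ht (.inr p)).queries h)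

theorem queries_resample {α : Type} {h : HashFamily n ℓ} {q : Fin ℓ × Bits n}
    {M : OracleAlg (Point n ℓ) (Val n ℓ) α} (v : Bits (3 * n)) (hq : .inr q ∉ M.queries h) :
    M.run (resample h q v) = M.run h ∧ M.queries (resample h q v) = M.queries h :=
  OracleAlg.run_queries_congr M fun p hp => resample_of_ne h v (by rintro rfl; exact hq hp)

/-- Otherwise undoing the resampling at `q` would not affect the run, and the original run would not
ask for `q` either. -/
theorem mem_queries_resample {α : Type} {h : HashFamily n ℓ} {q : Fin ℓ × Bits n}
    {M : OracleAlg (Point n ℓ) (Val n ℓ) α} (v : Bits (3 * n)) (hq : .inr q ∈ M.queries h) :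
    .inr q ∈ M.queries (resample h q v) := by
  by_contra hq'
  have h2 := (OracleAlg.run_queries_congr (O := resample h q v) (O' := h) M
    fun p hp => (resample_of_ne h v (by rintro rfl; exact hq' hp)).symm).2
  exact hq' (h2 ▸ hq)

section Resampling

variable {Ht : Subversion n ℓ} {R : Fin ℓ → Bits n} {h : HashFamily n ℓ}

/-- A run that asks for `q` is honest before and after, so it returns the family's own value at `p`,
which the change at `q` does not touch. A run that does not ask for `q` cannot notice the change. -/
theorem run_resample_of_ne {q : Fin ℓ × Bits n} {v : Bits (3 * n)} (hq : ¬ Leaked Ht h q)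
    (hq' : ¬ Leaked Ht (resample h q v) q) {p : Fin ℓ × Bits n} (hp : p ≠ q) :
    (Ht (.inr p)).run (resample h q v) = (Ht (.inr p)).run h := by
  by_cases hm : .inr q ∈ (Ht (.inr p)).queries h
  · have h1 : (Ht (.inr p)).run h = h (.inr p) := by
      by_contra hne
      exact hq ⟨p, hne, .inr hm⟩
    have h2 : (Ht (.inr p)).run (resample h q v) = resample h q v (.inr p) := by
      by_contra hne
      exact hq' ⟨p, hne, .inr (mem_queries_resample v hm)⟩
    rw [h1, h2, resample_of_ne h v (fun e => hp (Sum.inr.inj e))]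
  · exact (queries_resample v hm).1

theorem gTilde_resample_of_ne {x x' : Bits n} {j : Fin ℓ} {v : Bits (3 * n)}
    (hq : ¬ Leaked Ht h (j, x + R j)) (hq' : ¬ Leaked Ht (resample h (j, x + R j) v) (j, x + R j))
    (hx : x' ≠ x) : gTilde Ht R (resample h (j, x + R j) v) x' = gTilde Ht R h x' := by
  refine Finset.sum_congr rfl fun i _ => run_resample_of_ne hq hq' fun e => hx ?_
  obtain ⟨rfl, e⟩ := Prod.mk.inj e
  exact add_right_cancel e

/-- Only the summand of `j` changes; being unsubverted in both families, it passes from the old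
value to `v`. -/
theorem gTilde_resample_self {x : Bits n} {j : Fin ℓ} {v : Bits (3 * n)}
    (hq : ¬ Leaked Ht h (j, x + R j))
    (hq' : ¬ Leaked Ht (resample h (j, x + R j) v) (j, x + R j)) :
    gTilde Ht R (resample h (j, x + R j) v) x + h (.inr (j, x + R j)) = gTilde Ht R h x + v := by
  have h1 : (Ht (.inr (j, x + R j))).run h = h (.inr (j, x + R j)) := by
    by_contra hne
    exact hq ⟨_, hne, .inl rfl⟩
  have h2 : (Ht (.inr (j, x + R j))).run (resample h (j, x + R j) v) = v := by
    by_contra hne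
    exact hq' ⟨_, by rwa [resample_self], .inl rfl⟩
  unfold gTilde
  rw [← Finset.sum_erase_add _ _ (Finset.mem_univ j),
    ← Finset.sum_erase_add Finset.univ
      (fun i => ((Ht (.inr (i, x + R i))).run h : Bits (3 * n))) (Finset.mem_univ j), h1, h2]
  rw [Finset.sum_congr rfl fun i hi => run_resample_of_ne (p := (i, x + R i)) hq hq' fun e =>
    (Finset.ne_of_mem_erase hi) (Prod.mk.inj e).1]
  exact add_right_comm _ _ _

theorem eagerAnswer_resample {x : Bits n} {j : Fin ℓ} {v : Bits (3 * n)}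
    (hq : ¬ Leaked Ht h (j, x + R j)) (hq' : ¬ Leaked Ht (resample h (j, x + R j) v) (j, x + R j))
    {q : DQuery n ℓ} (hx : touched R q ≠ some x) :
    eagerAnswer Ht R (resample h (j, x + R j) v) q = eagerAnswer Ht R h q := by
  rcases q with x' | y | ⟨i, z⟩
  · simp only [eagerAnswer]
    rw [gTilde_resample_of_ne hq hq' (fun e => hx (by rw [e, touched])),
      resample_of_ne h v (by simp)]
  · exact resample_of_ne h v (by simp)
  · refine resample_of_ne h v fun e => hx ?_
    obtain ⟨rfl, rfl⟩ := Prod.mk.inj (Sum.inr.inj e)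
    simp only [touched, Bits.add_cancel]

theorem FirstTouch.unique {M : OracleAlg (DQuery n ℓ) (DAns n ℓ) Bool} {t : ℕ} {x x' : Bits n}
    (hx : FirstTouch Ht R M h t x) (hx' : FirstTouch Ht R M h t x') : x = x' :=
  Option.some.inj (hx.1.symm.trans hx'.1)

/-- Queries before `t` do not address `x`, so their answers survive. Query `t` itself is therefore
the same, although its answer may differ. -/
theorem take_queries_resample {M : OracleAlg (DQuery n ℓ) (DAns n ℓ) Bool} {t : ℕ} {x : Bits n}
    (hx : FirstTouch Ht R M h t x) {j : Fin ℓ} {v : Bits (3 * n)}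
    (hq : ¬ Leaked Ht h (j, x + R j))
    (hq' : ¬ Leaked Ht (resample h (j, x + R j) v) (j, x + R j)) :
    (M.queries (eagerAnswer Ht R (resample h (j, x + R j) v))).take (t + 1) =
      (M.queries (eagerAnswer Ht R h)).take (t + 1) :=
  OracleAlg.take_queries_congr M t fun q hqt => eagerAnswer_resample hq hq' (hx.2 q hqt)

theorem FirstTouch.resample {M : OracleAlg (DQuery n ℓ) (DAns n ℓ) Bool} {t : ℕ} {x : Bits n}
    (hx : FirstTouch Ht R M h t x) {j : Fin ℓ} {v : Bits (3 * n)}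
    (hq : ¬ Leaked Ht h (j, x + R j))
    (hq' : ¬ Leaked Ht (resample h (j, x + R j) v) (j, x + R j)) :
    FirstTouch Ht R M (resample h (j, x + R j) v) t x := by
  have e := take_queries_resample hx hq hq'
  constructor
  · rw [← List.getElem?_take_of_lt (Nat.lt_succ_self t), Nat.succ_eq_add_one, e,
      List.getElem?_take_of_lt (Nat.lt_succ_self t)]
    exact hx.1
  · intro q hq0
    rw [← min_eq_left (Nat.le_succ t), Nat.succ_eq_add_one, ← List.take_take, e, List.take_take,
      min_eq_left (Nat.le_succ t)] at hq0
    exact hx.2 q hq0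

/-- A source depends on at most one run of the subversion algorithm, at the point `p`; avoiding the
queries of that run is enough. `p₀` is a dummy for sources that involve no run. -/
theorem sourceValue_resample {m : ℕ} (σ : Option (Fin ℓ × Fin m)) {q : DQuery n ℓ} {x : Bits n}
    (hx : touched R q ≠ some x) (p₀ : Fin ℓ × Bits n) :
    ∃ p : Fin ℓ × Bits n, ∀ (j : Fin ℓ) (v : Bits (3 * n)), ¬ Leaked Ht h (j, x + R j) →
      ¬ Leaked Ht (resample h (j, x + R j) v) (j, x + R j) →
      .inr (j, x + R j) ∉ (Ht (.inr p)).queries h →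
      sourceValue Ht R (resample h (j, x + R j) v) q σ = sourceValue Ht R h q σ := by
  rcases σ with _ | ⟨i, k⟩
  · refine ⟨p₀, fun j v hq hq' _ => ?_⟩
    rcases q with x' | y | ⟨i, z⟩
    · simp only [sourceValue, touched, Option.map_some]
      rw [gTilde_resample_of_ne hq hq' (fun e => hx (by rw [e, touched]))]
    · rfl
    · simp only [sourceValue, touched, Option.map_some]
      rw [gTilde_resample_of_ne hq hq' (fun e => hx (by rw [← e, touched]))]
  · cases hq0 : touched R q with
    | none => exact ⟨p₀, fun j v _ _ _ => by simp [sourceValue, hq0]⟩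
    | some x' =>
      refine ⟨(i, x' + R i), fun j v _ _ hm => ?_⟩
      simp only [sourceValue, hq0, Option.bind_some, (queries_resample v hm).2]

/-- The contributing query precedes `t`, so it does not address `x`: in the resampled family its
source still shows the old g̃_R(x). This is what makes the old family recoverable. -/
theorem Hit.resample {m : ℕ} {M : OracleAlg (DQuery n ℓ) (DAns n ℓ) Bool} {t t' : ℕ}
    {σ : Option (Fin ℓ × Fin m)} {x : Bits n} (hh : Hit Ht R M h t t' σ x)
    (p₀ : Fin ℓ × Bits n) :
    ∃ p : Fin ℓ × Bits n, ∀ (j : Fin ℓ) (v : Bits (3 * n)), ¬ Leaked Ht h (j, x + R j) →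
      ¬ Leaked Ht (resample h (j, x + R j) v) (j, x + R j) →
      .inr (j, x + R j) ∉ (Ht (.inr p)).queries h →
      ((M.queries (eagerAnswer Ht R (resample h (j, x + R j) v)))[t']?).bind
        (fun q => sourceValue Ht R (resample h (j, x + R j) v) q σ) = some (gTilde Ht R h x) := by
  obtain ⟨hx, htt, hs⟩ := hh
  cases hq0 : (M.queries (eagerAnswer Ht R h))[t']? with
  | none => simp [hq0] at hs
  | some q₀ =>
    rw [hq0, Option.bind_some] at hs
    have hmem : q₀ ∈ (M.queries (eagerAnswer Ht R h)).take t := by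
      rw [← List.getElem?_take_of_lt htt] at hq0
      exact List.mem_of_getElem? hq0
    obtain ⟨p, hp⟩ := sourceValue_resample (Ht := Ht) (h := h) σ (hx.2 q₀ hmem) p₀
    refine ⟨p, fun j v hq hq' hm => ?_⟩
    rw [← List.getElem?_take_of_lt (htt.trans (Nat.lt_succ_self t)), Nat.succ_eq_add_one,
      take_queries_resample hx hq hq', List.getElem?_take_of_lt (htt.trans (Nat.lt_succ_self t)),
      hq0, Option.bind_some, hp j v hq hq' hm, hs]

end Resampling

/-! ### Counting the families for which a fixed source is hit -/

open Classical in
/-- The value at `q` is leaked, or it is leaked for most resampled values. -/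
def Bad (Ht : Subversion n ℓ) (h : HashFamily n ℓ) (q : Fin ℓ × Bits n) : Prop :=
  Leaked Ht h q ∨
    Fintype.card (Bits (3 * n)) <
      2 * (Finset.univ.filter fun v => Leaked Ht (resample h q v) q).card

open Classical in
/-- Every constellation has at least half of its points neither bad nor queried by any single run of
the subversion algorithm. -/
def Typical (Ht : Subversion n ℓ) (R : Fin ℓ → Bits n) (h : HashFamily n ℓ) : Prop :=
  ∀ (x : Bits n) (p : Fin ℓ × Bits n),
    2 * (Finset.univ.filter fun j : Fin ℓ =>
      Bad Ht h (j, x + R j) ∨ .inr (j, x + R j) ∈ (Ht (.inr p)).queries h).card ≤ ℓ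

/-- Double counting of triples (h, j, v). Injectivity for each fixed j suffices: the resulting
factor |J| cancels later, because `c` will be proportional to |J|. -/
theorem card_mul_le_of_injOn {J H V : Type} [Fintype J] [Fintype H] [Fintype V]
    (A : Finset H) (G : H → J → Finset V) (f : J → H → V → H) (c : ℕ)
    (hc : ∀ h ∈ A, c ≤ ∑ j, (G h j).card)
    (hf : ∀ j, ∀ h₁ ∈ A, ∀ h₂ ∈ A, ∀ v₁ ∈ G h₁ j, ∀ v₂ ∈ G h₂ j,
      f j h₁ v₁ = f j h₂ v₂ → h₁ = h₂ ∧ v₁ = v₂) :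
    A.card * c ≤ Fintype.card J * Fintype.card H := by
  calc A.card * c = ∑ _h ∈ A, c := by simp
    _ ≤ ∑ h ∈ A, ∑ j, (G h j).card := Finset.sum_le_sum hc
    _ = ∑ j, ∑ h ∈ A, (G h j).card := Finset.sum_comm
    _ ≤ ∑ _j : J, Fintype.card H := by
      refine Finset.sum_le_sum fun j _ => ?_
      rw [← Finset.card_sigma]
      refine Finset.card_le_card_of_injOn (t := Finset.univ) (fun a => f j a.1 a.2)
        (fun _ _ => Finset.mem_coe.2 (Finset.mem_univ _)) ?_
      rintro ⟨h₁, v₁⟩ ha ⟨h₂, v₂⟩ hb e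
      simp only [Finset.coe_sigma, Set.mem_sigma_iff, Finset.mem_coe] at ha hb
      obtain ⟨rfl, rfl⟩ := hf j h₁ ha.1 h₂ hb.1 v₁ ha.2 v₂ hb.2 e
      rfl
    _ = _ := by simp

open Classical in
theorem card_hit_mul_le {m : ℕ} (Ht : Subversion n ℓ) (R : Fin ℓ → Bits n) (hℓ : 0 < ℓ)
    (M : OracleAlg (DQuery n ℓ) (DAns n ℓ) Bool) (t t' : ℕ) (σ : Option (Fin ℓ × Fin m)) :
    (Finset.univ.filter fun h : HashFamily n ℓ =>
        Typical Ht R h ∧ ∃ x, Hit Ht R M h t t' σ x).card * Fintype.card (Bits (3 * n)) ≤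
      4 * Fintype.card (HashFamily n ℓ) := by
  set A := Finset.univ.filter fun h : HashFamily n ℓ =>
    Typical Ht R h ∧ ∃ x, Hit Ht R M h t t' σ x with hA
  set N := Fintype.card (Bits (3 * n)) with hN
  have key : ∀ h : HashFamily n ℓ, ∃ (x : Bits n) (p : Fin ℓ × Bits n), h ∈ A →
      Typical Ht R h ∧ Hit Ht R M h t t' σ x ∧
      ∀ (j : Fin ℓ) (v : Bits (3 * n)), ¬ Leaked Ht h (j, x + R j) →
      ¬ Leaked Ht (resample h (j, x + R j) v) (j, x + R j) →
      .inr (j, x + R j) ∉ (Ht (.inr p)).queries h →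
      ((M.queries (eagerAnswer Ht R (resample h (j, x + R j) v)))[t']?).bind
        (fun q => sourceValue Ht R (resample h (j, x + R j) v) q σ) = some (gTilde Ht R h x) := by
    intro h
    by_cases hh : h ∈ A
    · obtain ⟨h1, x, hx⟩ := (Finset.mem_filter.1 hh).2
      obtain ⟨p, hp⟩ := hx.resample (⟨0, hℓ⟩, 0)
      exact ⟨x, p, fun _ => ⟨h1, hx, hp⟩⟩
    · exact ⟨0, (⟨0, hℓ⟩, 0), fun hh' => absurd hh' hh⟩
  choose X P key using key
  let G : HashFamily n ℓ → Fin ℓ → Finset (Bits (3 * n)) := fun h j =>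
    Finset.univ.filter fun v => ¬ Leaked Ht h (j, X h + R j) ∧
      ¬ Leaked Ht (resample h (j, X h + R j) v) (j, X h + R j) ∧
      .inr (j, X h + R j) ∉ (Ht (.inr (P h))).queries h
  -- The constant is ℓN/4 rounded up: at least half of the indices, and for each of them at least
  -- half of the values.
  have main := card_mul_le_of_injOn (J := Fin ℓ) A (fun h j => G h j)
    (fun j h v => resample h (j, X h + R j) v) (ℓ * N / 4 + if 4 ∣ ℓ * N then 0 else 1) ?_ ?_
  · rw [Fintype.card_fin] at main
    have h4 : ℓ * N ≤ 4 * (ℓ * N / 4 + if 4 ∣ ℓ * N then 0 else 1) := by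
      split <;> omega
    have : ℓ * (A.card * N) ≤ ℓ * (4 * Fintype.card (HashFamily n ℓ)) := by
      calc ℓ * (A.card * N) = A.card * (ℓ * N) := by ring
        _ ≤ A.card * (4 * (ℓ * N / 4 + if 4 ∣ ℓ * N then 0 else 1)) :=
          Nat.mul_le_mul_left _ h4
        _ = 4 * (A.card * (ℓ * N / 4 + if 4 ∣ ℓ * N then 0 else 1)) := by ring
        _ ≤ 4 * (ℓ * Fintype.card (HashFamily n ℓ)) := Nat.mul_le_mul_left _ main
        _ = _ := by ring
    exact Nat.le_of_mul_le_mul_left this hℓ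
  · intro h hh
    obtain ⟨hT, -, -⟩ := key h hh
    set J := Finset.univ.filter fun j : Fin ℓ => Bad Ht h (j, X h + R j) ∨
      .inr (j, X h + R j) ∈ (Ht (.inr (P h))).queries h with hJ
    have hJc : 2 * J.card ≤ ℓ := by
      have := hT (X h) (P h)
      rwa [hJ]
    have h1 : ∀ j ∈ Jᶜ, N ≤ 2 * (G h j).card := by
      intro j hj
      rw [hJ, Finset.mem_compl, Finset.mem_filter, not_and] at hj
      have hj := hj (Finset.mem_univ _)
      simp only [Bad, not_or, not_lt] at hj
      obtain ⟨⟨hj1, hj2⟩, hj3⟩ := hj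
      have e : G h j = (Finset.univ.filter fun v =>
          Leaked Ht (resample h (j, X h + R j) v) (j, X h + R j))ᶜ := by
        ext v
        simp [G, hj1, hj3]
      rw [e, Finset.card_compl]
      omega
    have h2 : Jᶜ.card * N ≤ 2 * ∑ j, (G h j).card := by
      calc Jᶜ.card * N = ∑ _j ∈ Jᶜ, N := by simp
        _ ≤ ∑ j ∈ Jᶜ, 2 * (G h j).card := Finset.sum_le_sum h1
        _ ≤ ∑ j, 2 * (G h j).card := Finset.sum_le_univ_sum_of_nonneg (fun _ => Nat.zero_le _)
        _ = _ := (Finset.mul_sum ..).symm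
    rw [Finset.card_compl, Fintype.card_fin] at h2
    have h3 : ℓ * N ≤ 4 * ∑ j, (G h j).card := by
      have : ℓ ≤ 2 * (ℓ - J.card) := by omega
      calc ℓ * N ≤ 2 * (ℓ - J.card) * N := Nat.mul_le_mul_right _ this
        _ = 2 * ((ℓ - J.card) * N) := by ring
        _ ≤ 2 * (2 * ∑ j, (G h j).card) := Nat.mul_le_mul_left _ h2
        _ = _ := by ring
    split <;> omega
  · intro j h₁ m₁ h₂ m₂ v₁ hv₁ v₂ hv₂ e
    obtain ⟨-, k1, k1'⟩ := key h₁ m₁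
    obtain ⟨-, k2, k2'⟩ := key h₂ m₂
    simp only [G, Finset.mem_filter, Finset.mem_univ, true_and] at hv₁ hv₂
    obtain ⟨a1, a2, a3⟩ := hv₁
    obtain ⟨b1, b2, b3⟩ := hv₂
    have f1 := k1.1.resample a1 a2
    have f2 := k2.1.resample b1 b2
    have s1 := k1' j v₁ a1 a2 a3
    have s2 := k2' j v₂ b1 b2 b3
    have g1 := gTilde_resample_self a1 a2
    have g2 := gTilde_resample_self b1 b2
    -- The common image reveals `x` as the constellation first addressed by query `t`.
    have hX : X h₁ = X h₂ := by
      rw [e] at f1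
      exact f1.unique f2
    rw [← hX] at e s2 g2
    have hv : v₁ = v₂ := by
      have := congrFun e (.inr (j, X h₁ + R j))
      rwa [resample_self, resample_self] at this
    rw [e] at s1 g1
    -- The source, read in the common image, shows both old values of g̃_R(x), so these agree; the
    -- translation identity then yields the old value at the resampled point.
    have hg := Option.some.inj (s1.symm.trans s2)
    refine ⟨funext fun p => ?_, hv⟩
    by_cases hp : p = .inr (j, X h₁ + R j)
    · subst hp
      rw [hv, hg, ← g2] at g1
      exact add_left_cancel g1
    · have := congrFun e p
      rwa [resample_of_ne _ _ hp, resample_of_ne _ _ hp] at this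

/-! ### Uniform probabilities -/

section UniformProb

variable {Ω : Type} [Fintype Ω]

theorem uniformProb_eq (E : Ω → Prop) [DecidablePred E] :
    uniformProb Ω E = ((Finset.univ.filter E).card : ℝ) / (Fintype.card Ω : ℝ) := by
  unfold uniformProb
  congr!

theorem uniformProb_nonneg (E : Ω → Prop) : 0 ≤ uniformProb Ω E := by
  unfold uniformProb
  positivity

theorem uniformProb_mono {E E' : Ω → Prop} (hE : ∀ ω, E ω → E' ω) :
    uniformProb Ω E ≤ uniformProb Ω E' := by
  classical
  unfold uniformProb
  gcongr with ω hω
  exact hE ω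

theorem uniformProb_le_of_card_le [Nonempty Ω] {E : Ω → Prop} [DecidablePred E] {c : ℝ}
    (hc : ((Finset.univ.filter E).card : ℝ) ≤ c * Fintype.card Ω) :
    uniformProb Ω E ≤ c := by
  rw [uniformProb_eq, div_le_iff₀ (by exact_mod_cast Fintype.card_pos)]
  exact hc

theorem card_le_of_uniformProb_le [Nonempty Ω] {E : Ω → Prop} [DecidablePred E] {c : ℝ}
    (hc : uniformProb Ω E ≤ c) : ((Finset.univ.filter E).card : ℝ) ≤ c * Fintype.card Ω := by
  rwa [uniformProb_eq, div_le_iff₀ (by exact_mod_cast Fintype.card_pos)] at hc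

theorem uniformProb_or_le (E E' : Ω → Prop) :
    uniformProb Ω (fun ω => E ω ∨ E' ω) ≤ uniformProb Ω E + uniformProb Ω E' := by
  classical
  simp only [uniformProb_eq]
  rw [← add_div]
  gcongr
  rw [Finset.filter_or]
  exact_mod_cast Finset.card_union_le _ _

theorem uniformProb_exists_le {ι : Type} [Fintype ι] (E : ι → Ω → Prop) {c : ℝ}
    (hc : ∀ i, uniformProb Ω (E i) ≤ c) :
    uniformProb Ω (fun ω => ∃ i, E i ω) ≤ Fintype.card ι * c := by
  classical
  calc uniformProb Ω (fun ω => ∃ i, E i ω) ≤ ∑ i, uniformProb Ω (E i) := by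
        simp only [uniformProb_eq]
        rw [← Finset.sum_div]
        gcongr
        have : Finset.univ.filter (fun ω => ∃ i, E i ω) =
            Finset.univ.biUnion fun i => Finset.univ.filter (E i) := by
          ext; simp
        rw [this]
        exact_mod_cast Finset.card_biUnion_le
    _ ≤ ∑ _i : ι, c := Finset.sum_le_sum fun i _ => hc i
    _ = _ := by simp

theorem uniformProb_prod_le {A B : Type} [Fintype A] [Fintype B] [Nonempty A] [Nonempty B]
    (E : A × B → Prop) {c : ℝ} (hc : ∀ a, uniformProb B (fun b => E (a, b)) ≤ c) :
    uniformProb (A × B) E ≤ c := by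
  classical
  refine uniformProb_le_of_card_le ?_
  have e : (Finset.univ.filter E).card =
      ∑ a, (Finset.univ.filter fun b => E (a, b)).card := by
    simp only [Finset.card_filter, Fintype.sum_prod_type]
  calc ((Finset.univ.filter E).card : ℝ) =
        ∑ a, ((Finset.univ.filter fun b => E (a, b)).card : ℝ) := by exact_mod_cast e
    _ ≤ ∑ _a : A, c * Fintype.card B :=
        Finset.sum_le_sum fun a _ => card_le_of_uniformProb_le (hc a)
    _ = _ := by
        rw [Fintype.card_prod, Finset.sum_const, Finset.card_univ, nsmul_eq_mul]
        push_cast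
        ring

theorem uniformProb_prod_le' {A B : Type} [Fintype A] [Fintype B] [Nonempty A] [Nonempty B]
    (E : A × B → Prop) {c : ℝ} (hc : ∀ b, uniformProb A (fun a => E (a, b)) ≤ c) :
    uniformProb (A × B) E ≤ c := by
  classical
  refine le_trans (le_of_eq ?_) (uniformProb_prod_le (fun p : B × A => E (p.2, p.1)) hc)
  simp only [uniformProb_eq]
  rw [Fintype.card_prod, Fintype.card_prod, mul_comm]
  congr 2
  exact Finset.card_equiv (Equiv.prodComm A B) (by simp)

end UniformProb

theorem card_bits (m : ℕ) : Fintype.card (Bits m) = 2 ^ m := by simp [Bits, ZMod.card]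

instance instNonemptyVal (n ℓ : ℕ) : (p : Point n ℓ) → Nonempty (Val n ℓ p)
  | .inl _ => ⟨(0 : Bits n)⟩
  | .inr _ => ⟨(0 : Bits (3 * n))⟩

/-! ### Hits in typical families -/

theorem uniformProb_hit_le {m : ℕ} (d : ℕ) (Ht : Subversion n ℓ) (R : Fin ℓ → Bits n) (hℓ : 0 < ℓ)
    (M : OracleAlg (DQuery n ℓ) (DAns n ℓ) Bool) :
    uniformProb (HashFamily n ℓ) (fun h => Typical Ht R h ∧
      ∃ (t t' : Fin d) (σ : Option (Fin ℓ × Fin m)), ∃ x, Hit Ht R M h t t' σ x) ≤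
      d * (d * ((ℓ * m + 1) * (4 / 2 ^ (3 * n)))) := by
  classical
  have h1 : ∀ (t t' : Fin d) (σ : Option (Fin ℓ × Fin m)), uniformProb (HashFamily n ℓ)
      (fun h => Typical Ht R h ∧ ∃ x, Hit Ht R M h t t' σ x) ≤ 4 / 2 ^ (3 * n) := by
    intro t t' σ
    refine uniformProb_le_of_card_le ?_
    have := card_hit_mul_le Ht R hℓ M t t' σ
    rw [card_bits] at this
    rw [div_mul_eq_mul_div, le_div_iff₀ (by positivity)]
    exact_mod_cast this
  have h2 := uniformProb_exists_le _ fun t : Fin d => uniformProb_exists_le _ fun t' : Fin d =>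
    uniformProb_exists_le _ (h1 t t')
  simp only [Fintype.card_option, Fintype.card_prod, Fintype.card_fin, Nat.cast_add, Nat.cast_mul,
    Nat.cast_one] at h2
  refine le_trans (uniformProb_mono ?_) h2
  rintro h ⟨hT, t, t', σ, x, hx⟩
  exact ⟨t, t', σ, hT, x, hx⟩

/-! ### Random shifts rarely meet small sets in half of the coordinates -/

theorem uniformProb_forall_mem_le (B : Fin ℓ → Finset (Bits n)) (J : Finset (Fin ℓ)) {β : ℝ}
    (hB : ∀ j, ((B j).card : ℝ) ≤ β * 2 ^ n) (x : Bits n) :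
    uniformProb (Fin ℓ → Bits n) (fun R => ∀ j ∈ J, x + R j ∈ B j) ≤ β ^ J.card := by
  classical
  refine uniformProb_le_of_card_le ?_
  have e : (Finset.univ.filter fun R : Fin ℓ → Bits n => ∀ j ∈ J, x + R j ∈ B j) =
      Fintype.piFinset fun j =>
        if j ∈ J then Finset.univ.filter fun w => x + w ∈ B j else Finset.univ := by
    ext R
    simp only [Finset.mem_filter, Finset.mem_univ, true_and, Fintype.mem_piFinset]
    refine forall_congr' fun j => ?_
    split <;> simp [*]
  have hs : ∀ j, ((Finset.univ.filter fun w => x + w ∈ B j).card : ℝ) ≤ β * 2 ^ n := by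
    intro j
    refine le_trans ?_ (hB j)
    exact_mod_cast Finset.card_le_card_of_injOn (fun w => x + w) (by intro w; simp)
      (fun a _ b _ h => add_left_cancel h)
  rw [e, Fintype.card_piFinset]
  push_cast
  calc ∏ j, ((if j ∈ J then Finset.univ.filter fun w => x + w ∈ B j else Finset.univ).card : ℝ)
      ≤ ∏ j, ((if j ∈ J then β else 1) * 2 ^ n) := by
        refine Finset.prod_le_prod (fun _ _ => by positivity) fun j _ => ?_
        split
        · exact hs j
        · simp
    _ = _ := by
        rw [Finset.prod_mul_distrib]
        simp

/-- Union bound over the at most 2^ℓ sets of coordinates that could be the majority. -/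
theorem uniformProb_half_le (B : Fin ℓ → Finset (Bits n)) {β : ℝ} (hβ : 0 ≤ β) (hβ1 : β ≤ 1)
    (hB : ∀ j, ((B j).card : ℝ) ≤ β * 2 ^ n) (x : Bits n) :
    uniformProb (Fin ℓ → Bits n)
      (fun R => ℓ < 2 * (Finset.univ.filter fun j => x + R j ∈ B j).card) ≤
      2 ^ ℓ * β ^ (ℓ / 2) := by
  have h1 := uniformProb_exists_le (Ω := Fin ℓ → Bits n) (c := β ^ (ℓ / 2))
    (fun (J : Finset (Fin ℓ)) R => ℓ < 2 * J.card ∧ ∀ j ∈ J, x + R j ∈ B j) fun J => by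
      by_cases hJ : ℓ < 2 * J.card
      · refine le_trans (uniformProb_mono fun R hR => hR.2) ?_
        refine le_trans (uniformProb_forall_mem_le B J hB x) ?_
        exact pow_le_pow_of_le_one hβ hβ1 (by omega)
      · refine le_trans (le_of_eq ?_) (pow_nonneg hβ _)
        simp [uniformProb, hJ]
  rw [Fintype.card_finset, Fintype.card_fin] at h1
  push_cast at h1
  exact le_trans (uniformProb_mono fun R hR => ⟨_, hR, fun j hj => (Finset.mem_filter.1 hj).2⟩) h1

open Classical in
theorem card_mem_queries_le (L : List (Point n ℓ)) (j : Fin ℓ) :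
    (Finset.univ.filter fun w : Bits n => Sum.inr (j, w) ∈ L).card ≤ L.length := by
  refine le_trans (Finset.card_le_card_of_injOn (t := L.toFinset)
    (fun w => (Sum.inr (j, w) : Point n ℓ)) ?_ ?_) (List.toFinset_card_le L)
  · intro w hw
    simpa using hw
  · intro a _ b _ h
    simpa using h

-- `h` is fixed, so the sets to be avoided do not depend on `R`. The union runs over all `x` and
-- `p`, since both may depend on `R` when this is applied; m/2^n is the share of inputs that one run
-- can query.
open Classical in
theorem uniformProb_not_typical_le {Ht : Subversion n ℓ} {m : ℕ} (hm : ∀ p, (Ht p).QueryBound m)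
    (h : HashFamily n ℓ) {η : ℝ} (hη : 0 ≤ η) (hη1 : η + m / 2 ^ n ≤ 1)
    (hB : ∀ j, ((Finset.univ.filter fun w => Bad Ht h (j, w)).card : ℝ) ≤ η * 2 ^ n) :
    uniformProb (Fin ℓ → Bits n) (fun R => ¬ Typical Ht R h) ≤
      2 ^ n * (ℓ * 2 ^ n * (2 ^ ℓ * (η + m / 2 ^ n) ^ (ℓ / 2))) := by
  have h1 := uniformProb_exists_le _ fun x : Bits n => uniformProb_exists_le _
    fun p : Fin ℓ × Bits n => uniformProb_half_le (β := η + m / 2 ^ n)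
      (fun j => Finset.univ.filter fun w =>
        Bad Ht h (j, w) ∨ .inr (j, w) ∈ (Ht (.inr p)).queries h) (by positivity) hη1 (fun j => by
      rw [Finset.filter_or, add_mul, div_mul_cancel₀ _ (by positivity)]
      refine le_trans (Nat.cast_le.2 (Finset.card_union_le _ _)) ?_
      rw [Nat.cast_add]
      exact add_le_add (hB j)
        (Nat.cast_le.2 ((card_mem_queries_le _ j).trans (hm _ h)))) x
  simp only [Fintype.card_prod, Fintype.card_fin, card_bits, Nat.cast_mul, Nat.cast_pow,
    Nat.cast_ofNat] at h1
  refine le_trans (uniformProb_mono fun R hR => ?_) h1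
  simp only [Typical, not_forall, not_le] at hR
  obtain ⟨x, p, hxp⟩ := hR
  exact ⟨x, p, by simpa using hxp⟩

/-! ### Few points are bad, for most families -/

-- A leaked point of index `j` is subverted itself (the summand 1), or is one of the at most `m`
-- queries made at a subverted point of one of the ℓ indices.
open Classical in
theorem card_leaked_le {Ht : Subversion n ℓ} {m : ℕ} (hm : ∀ p, (Ht p).QueryBound m) {ε : ℝ}
    (hε : Ht.DisagreementAtMost ε) (h : HashFamily n ℓ) (j : Fin ℓ) :
    ((Finset.univ.filter fun w => Leaked Ht h (j, w)).card : ℝ) ≤ (ℓ * m + 1) * ε * 2 ^ n := by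
  set S : Fin ℓ → Finset (Bits n) := fun i =>
    Finset.univ.filter fun z => (Ht (.inr (i, z))).run h ≠ h (.inr (i, z)) with hS
  have hSc : ∀ i, ((S i).card : ℝ) ≤ ε * 2 ^ n := fun i => by
    have := card_le_of_uniformProb_le ((hε h).2 i)
    rw [card_bits] at this
    exact_mod_cast this
  have hsub : (Finset.univ.filter fun w => Leaked Ht h (j, w)) ⊆
      S j ∪ Finset.univ.biUnion fun i => (S i).biUnion fun z =>
        Finset.univ.filter fun w => Sum.inr (j, w) ∈ (Ht (.inr (i, z))).queries h := by
    intro w hw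
    obtain ⟨⟨i, z⟩, hne, hq⟩ := (Finset.mem_filter.1 hw).2
    simp only [Finset.mem_union, Finset.mem_biUnion, hS, Finset.mem_filter, Finset.mem_univ,
      true_and]
    rcases hq with hq | hq
    · left
      rwa [← hq]
    · exact .inr ⟨i, z, hne, hq⟩
  have h1 : (Finset.univ.filter fun w => Leaked Ht h (j, w)).card ≤
      (S j).card + ∑ i, (S i).card * m := by
    refine (Finset.card_le_card hsub).trans ((Finset.card_union_le _ _).trans ?_)
    gcongr
    refine Finset.card_biUnion_le.trans (Finset.sum_le_sum fun i _ => ?_)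
    exact Finset.card_biUnion_le_card_mul _ _ _ fun z _ =>
      (card_mem_queries_le _ j).trans (hm _ h)
  calc ((Finset.univ.filter fun w => Leaked Ht h (j, w)).card : ℝ)
      ≤ (S j).card + ∑ i, ((S i).card : ℝ) * m := by exact_mod_cast h1
    _ ≤ ε * 2 ^ n + ∑ _i : Fin ℓ, ε * 2 ^ n * m := by
        gcongr with i
        · exact hSc j
        · exact hSc i
    _ = _ := by
        simp only [Finset.sum_const, Finset.card_univ, Fintype.card_fin, nsmul_eq_mul]
        ring

-- Exchanging `v` with the value of the family at `q` is an involution, so resampling preserves the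
-- uniform measure.
open Classical in
theorem sum_card_resample (q : Fin ℓ × Bits n) (P : HashFamily n ℓ → Prop) :
    ∑ h : HashFamily n ℓ, (Finset.univ.filter fun v => P (resample h q v)).card =
      (Finset.univ.filter P).card * Fintype.card (Bits (3 * n)) := by
  let e : HashFamily n ℓ × Bits (3 * n) → HashFamily n ℓ × Bits (3 * n) :=
    fun a => (resample a.1 q a.2, a.1 (.inr q))
  have he : Function.Involutive e := by
    rintro ⟨h, v⟩
    refine Prod.ext (funext fun p => ?_) (resample_self h q v)
    by_cases hp : p = .inr q
    · subst hp
      exact resample_self _ _ _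
    · exact (resample_of_ne _ _ hp).trans (resample_of_ne _ _ hp)
  calc ∑ h : HashFamily n ℓ, (Finset.univ.filter fun v => P (resample h q v)).card
      = ∑ a : HashFamily n ℓ × Bits (3 * n), if P (e a).1 then 1 else 0 := by
        simp only [Finset.card_filter, Fintype.sum_prod_type, e]
    _ = ∑ a : HashFamily n ℓ × Bits (3 * n), if P a.1 then 1 else 0 :=
        Equiv.sum_comp he.toPerm (fun a : HashFamily n ℓ × Bits (3 * n) => if P a.1 then 1 else 0)
    _ = _ := by
        rw [Fintype.sum_prod_type, Finset.card_filter, Finset.sum_mul]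
        refine Finset.sum_congr rfl fun h _ => ?_
        split <;> simp

-- 3 = 1 + 2: being leaked now, plus Markov's inequality at threshold 1/2 for being leaked after
-- resampling.
open Classical in
theorem card_bad_le (Ht : Subversion n ℓ) (q : Fin ℓ × Bits n) :
    (Finset.univ.filter fun h => Bad Ht h q).card ≤
      3 * (Finset.univ.filter fun h => Leaked Ht h q).card := by
  set N := Fintype.card (Bits (3 * n)) with hN
  set c : HashFamily n ℓ → ℕ := fun h =>
    (Finset.univ.filter fun v => Leaked Ht (resample h q v) q).card with hc
  have h1 : (Finset.univ.filter fun h => N < 2 * c h).card * N ≤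
      2 * (Finset.univ.filter fun h => Leaked Ht h q).card * N := by
    calc (Finset.univ.filter fun h => N < 2 * c h).card * N
        = ∑ _h ∈ Finset.univ.filter fun h => N < 2 * c h, N := by simp
      _ ≤ ∑ h ∈ Finset.univ.filter fun h => N < 2 * c h, 2 * c h :=
          Finset.sum_le_sum fun h hh => (Finset.mem_filter.1 hh).2.le
      _ ≤ ∑ h, 2 * c h := Finset.sum_le_univ_sum_of_nonneg fun _ => Nat.zero_le _
      _ = _ := by
          rw [← Finset.mul_sum, sum_card_resample q fun h => Leaked Ht h q, mul_assoc]
  have h2 := Nat.le_of_mul_le_mul_right h1 (by rw [hN]; exact Fintype.card_pos)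
  have h3 : (Finset.univ.filter fun h => Bad Ht h q) =
      (Finset.univ.filter fun h => Leaked Ht h q) ∪ Finset.univ.filter fun h => N < 2 * c h := by
    ext h
    simp [Bad, hc, hN]
  rw [h3]
  refine (Finset.card_union_le _ _).trans ?_
  omega

-- Leaked points are few for each family, while bad and leaked are compared for each point over all
-- families; exchanging the two sums links these bounds before Markov's inequality is applied.
open Classical in
theorem uniformProb_exists_bad_le {Ht : Subversion n ℓ} {m : ℕ} (hm : ∀ p, (Ht p).QueryBound m)
    {ε : ℝ} (hε : Ht.DisagreementAtMost ε) {η : ℝ} (hη : 0 < η) :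
    uniformProb (HashFamily n ℓ) (fun h =>
      ∃ j, η * 2 ^ n < ((Finset.univ.filter fun w => Bad Ht h (j, w)).card : ℝ)) ≤
      ℓ * (3 * ((ℓ * m + 1) * ε) / η) := by
  have h1 := uniformProb_exists_le (Ω := HashFamily n ℓ) (c := 3 * ((ℓ * m + 1) * ε) / η)
    (fun (j : Fin ℓ) h => η * 2 ^ n < ((Finset.univ.filter fun w => Bad Ht h (j, w)).card : ℝ))
    fun j => by
      refine uniformProb_le_of_card_le ?_
      set T := Finset.univ.filter fun h : HashFamily n ℓ =>
        η * 2 ^ n < ((Finset.univ.filter fun w => Bad Ht h (j, w)).card : ℝ) with hT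
      have hpow : (0 : ℝ) < 2 ^ n := by positivity
      have swap : ∀ P : HashFamily n ℓ → Bits n → Prop,
          ∑ h, (Finset.univ.filter fun w => P h w).card =
            ∑ w, (Finset.univ.filter fun h => P h w).card := by
        intro P
        simp only [Finset.card_filter]
        exact Finset.sum_comm
      have k1 : ∑ h : HashFamily n ℓ, (Finset.univ.filter fun w => Bad Ht h (j, w)).card ≤
          3 * ∑ h : HashFamily n ℓ, (Finset.univ.filter fun w => Leaked Ht h (j, w)).card := by
        rw [swap, swap, Finset.mul_sum]
        exact Finset.sum_le_sum fun w _ => card_bad_le Ht (j, w)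
      have k2 : (T.card : ℝ) * (η * 2 ^ n) ≤
          3 * ((ℓ * m + 1) * ε) * Fintype.card (HashFamily n ℓ) * 2 ^ n := by
        calc (T.card : ℝ) * (η * 2 ^ n) = ∑ _h ∈ T, η * 2 ^ n := by simp
          _ ≤ ∑ h ∈ T, ((Finset.univ.filter fun w => Bad Ht h (j, w)).card : ℝ) :=
              Finset.sum_le_sum fun h hh => (Finset.mem_filter.1 hh).2.le
          _ ≤ ∑ h, ((Finset.univ.filter fun w => Bad Ht h (j, w)).card : ℝ) :=
              Finset.sum_le_univ_sum_of_nonneg fun _ => Nat.cast_nonneg _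
          _ ≤ 3 * ∑ h, ((Finset.univ.filter fun w => Leaked Ht h (j, w)).card : ℝ) := by
              exact_mod_cast k1
          _ ≤ 3 * ∑ _h : HashFamily n ℓ, (ℓ * m + 1) * ε * 2 ^ n := by
              gcongr with h
              exact card_leaked_le hm hε h j
          _ = _ := by
              rw [Finset.sum_const, Finset.card_univ, nsmul_eq_mul]
              ring
      rw [div_mul_eq_mul_div, le_div_iff₀ hη]
      refine le_of_mul_le_mul_right ?_ hpow
      rwa [mul_assoc]
  rwa [Fintype.card_fin] at h1

/-! ### The bound for fixed parameters -/

/-- Three cases: some index has too many bad points; none has, but `R` is atypical; or the pair is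
typical and hit. The second case uses the independence of `R` and `h`, by averaging over `R` with
`h` fixed. -/
theorem predProb_le {U : Type} [Fintype U] [Nonempty U] (hℓ : 0 < ℓ) {Ht : Subversion n ℓ}
    {D : U → Distinguisher n ℓ} {m d : ℕ} (hm : ∀ p, (Ht p).QueryBound m) {ε : ℝ}
    (hε : Ht.DisagreementAtMost ε) (hd : ∀ u R, (D u R).QueryBound d) {η : ℝ} (hη : 0 < η)
    (hη1 : η + m / 2 ^ n ≤ 1) :
    predProb U Ht D ≤ ℓ * (3 * ((ℓ * m + 1) * ε) / η) +
      2 ^ n * (ℓ * 2 ^ n * (2 ^ ℓ * (η + m / 2 ^ n) ^ (ℓ / 2))) +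
      d * (d * ((ℓ * m + 1) * (4 / 2 ^ (3 * n)))) := by
  classical
  let B : HashFamily n ℓ → Prop := fun h =>
    ∃ j, η * 2 ^ n < ((Finset.univ.filter fun w => Bad Ht h (j, w)).card : ℝ)
  have h1 : uniformProb (U × (Fin ℓ → Bits n) × HashFamily n ℓ) (fun ω => B ω.2.2) ≤ _ :=
    uniformProb_prod_le _ fun u => uniformProb_prod_le _ fun R =>
      uniformProb_exists_bad_le hm hε hη
  have h2 : uniformProb (U × (Fin ℓ → Bits n) × HashFamily n ℓ)
      (fun ω => ¬ B ω.2.2 ∧ ¬ Typical Ht ω.2.1 ω.2.2) ≤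
      2 ^ n * (ℓ * 2 ^ n * (2 ^ ℓ * (η + m / 2 ^ n) ^ (ℓ / 2))) :=
    uniformProb_prod_le _ fun u => uniformProb_prod_le' _ fun h => by
      by_cases hB : B h
      · refine le_trans (le_of_eq ?_) (by positivity)
        simp [uniformProb, hB]
      · refine le_trans (uniformProb_mono fun R hR => hR.2)
          (uniformProb_not_typical_le hm h hη.le hη1 fun j => ?_)
        exact not_lt.1 fun hj => hB ⟨j, hj⟩
  have h3 : uniformProb (U × (Fin ℓ → Bits n) × HashFamily n ℓ)
      (fun ω => Typical Ht ω.2.1 ω.2.2 ∧ ∃ (t t' : Fin d) (σ : Option (Fin ℓ × Fin m)), ∃ x,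
        Hit Ht ω.2.1 (D ω.1 ω.2.1) ω.2.2 t t' σ x) ≤ _ :=
    uniformProb_prod_le _ fun u => uniformProb_prod_le _ fun R =>
      uniformProb_hit_le d Ht R hℓ (D u R)
  refine le_trans (uniformProb_mono fun ω hω => ?_) ((uniformProb_or_le _ _).trans
    (add_le_add ((uniformProb_or_le _ _).trans (add_le_add h1 h2)) h3))
  by_cases hB : B ω.2.2
  · exact .inl (.inl hB)
  by_cases hT : Typical Ht ω.2.1 ω.2.2
  · exact .inr ⟨hT, hω.exists_hit hm (hd _ _)⟩
  · exact .inl (.inr ⟨hB, hT⟩)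

/-! ### Asymptotics -/

/-- Here `s` stands for ε^(1/16). The slack `u` keeps the threshold positive even when ε = 0. -/
theorem markov_term_le {ℓ m : ℕ} {s u : ℝ} (hs : 0 ≤ s) (hu : 0 < u) (hs1 : s ≤ 1) (hℓ : 1 ≤ ℓ)
    (hm : 1 ≤ m) (hP : 6 * (ℓ : ℝ) ^ 2 * m * s ≤ 1) :
    ℓ * (3 * ((ℓ * m + 1) * s ^ 16) / (s ^ 8 + u)) ≤ s := by
  have hℓ' : (1 : ℝ) ≤ ℓ := by exact_mod_cast hℓ
  have hm' : (1 : ℝ) ≤ m := by exact_mod_cast hm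
  have h1 : s ^ 16 / (s ^ 8 + u) ≤ s ^ 8 := by
    rw [div_le_iff₀ (by positivity)]
    have : 0 ≤ s ^ 8 * u := by positivity
    nlinarith
  have h2 : (ℓ : ℝ) * m + 1 ≤ 2 * (ℓ * m) := by nlinarith
  have h3 : s ^ 7 ≤ s := pow_le_of_le_one hs hs1 (by norm_num)
  calc ℓ * (3 * ((ℓ * m + 1) * s ^ 16) / (s ^ 8 + u))
      = ℓ * (3 * ((ℓ * m + 1) * (s ^ 16 / (s ^ 8 + u)))) := by ring
    _ ≤ ℓ * (3 * (2 * (ℓ * m) * s ^ 8)) := by gcongr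
    _ = (6 * (ℓ : ℝ) ^ 2 * m * s) * s ^ 7 := by ring
    _ ≤ 1 * s := by gcongr
    _ = s := one_mul s

theorem atypical_term_le {n ℓ m : ℕ} {s : ℝ} (hs : 0 ≤ s) (hs1 : s ≤ 1) (hn : 8 ≤ n)
    (hℓ : n + 4 < ℓ) (hP : 1024 * (ℓ : ℝ) * s ≤ 1)
    (hb : 2 * 8 ^ 6 * (ℓ : ℝ) * (m + 1) ^ 6 ≤ 2 ^ n) :
    2 ^ n * (ℓ * 2 ^ n * (2 ^ ℓ * (s ^ 8 + 1 / 2 ^ n + m / 2 ^ n) ^ (ℓ / 2))) ≤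
      s + 1 / 2 ^ (3 * n) := by
  obtain ⟨k, hk⟩ : ∃ k, k = ℓ / 2 := ⟨_, rfl⟩
  -- From n ≥ 8 comes ℓ ≥ 13. Six factors of `b` give 2^(-6n) against the 2^(2n) of the union bound;
  -- the remaining 2^(-4n) absorbs the polynomial factors and still leaves 2^(-3n).
  have hk6 : 6 ≤ k := by omega
  have hℓk : ℓ ≤ 2 * k + 1 := by omega
  have hℓ' : (1 : ℝ) ≤ ℓ := by exact_mod_cast (by omega : 1 ≤ ℓ)
  have hm1 : (1 : ℝ) ≤ m + 1 := by linarith [Nat.cast_nonneg (α := ℝ) m]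
  set b : ℝ := (m + 1) / 2 ^ n with hbdef
  have hb0 : 0 ≤ b := by positivity
  have hb1 : 8 * b ≤ 1 := by
    rw [hbdef, ← mul_div_assoc, div_le_one (by positivity)]
    refine le_trans ?_ hb
    have h6 : (m + 1 : ℝ) ≤ (m + 1) ^ 6 := le_self_pow₀ hm1 (by norm_num)
    have h0 : (0 : ℝ) ≤ (m + 1) ^ 6 := by positivity
    have : (m + 1 : ℝ) ^ 6 ≤ ℓ * (m + 1) ^ 6 := le_mul_of_one_le_left h0 hℓ'
    linarith
  have hpow : (s ^ 8 + 1 / 2 ^ n + m / 2 ^ n : ℝ) ^ (ℓ / 2) ≤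
      2 ^ k * ((s ^ 8) ^ k + b ^ k) := by
    have e : (s ^ 8 + 1 / 2 ^ n + m / 2 ^ n : ℝ) = s ^ 8 + b := by rw [hbdef]; ring
    rw [e, ← hk]
    refine (add_pow_le (by positivity) hb0 k).trans ?_
    gcongr
    · norm_num
    · omega
  have h2ℓ : (2 : ℝ) ^ ℓ ≤ 2 * 4 ^ k := by
    calc (2 : ℝ) ^ ℓ ≤ 2 ^ (2 * k + 1) := pow_le_pow_right₀ (by norm_num) hℓk
      _ = _ := by rw [pow_succ, pow_mul]; norm_num; ring
  have h2n : (2 : ℝ) ^ n * 2 ^ n ≤ 4 * 16 ^ k := by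
    calc (2 : ℝ) ^ n * 2 ^ n = 2 ^ (n + n) := (pow_add _ _ _).symm
      _ ≤ 2 ^ (4 * k + 2) := pow_le_pow_right₀ (by norm_num) (by omega)
      _ = _ := by rw [pow_add, pow_mul]; norm_num; ring
  have hs8 : s ^ 8 ≤ s := pow_le_of_le_one hs hs1 (by norm_num)
  have hr1 : 128 * s ^ 8 ≤ 1 := by nlinarith
  have t1 : 8 * (ℓ : ℝ) * (128 * s ^ 8) ^ k ≤ s := by
    calc 8 * (ℓ : ℝ) * (128 * s ^ 8) ^ k ≤ 8 * ℓ * (128 * s ^ 8) := by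
          gcongr
          exact pow_le_of_le_one (by positivity) hr1 (by omega)
      _ = (1024 * (ℓ : ℝ) * s) * s ^ 7 := by ring
      _ ≤ 1 * s := by
          gcongr
          exact pow_le_of_le_one hs hs1 (by norm_num)
      _ = s := one_mul s
  have t2 : 2 * (ℓ : ℝ) * (2 ^ n * 2 ^ n) * (8 * b) ^ k ≤ 1 / 2 ^ (3 * n) := by
    calc 2 * (ℓ : ℝ) * (2 ^ n * 2 ^ n) * (8 * b) ^ k
        ≤ 2 * ℓ * (2 ^ n * 2 ^ n) * (8 * b) ^ 6 := by
          gcongr 2 * (ℓ : ℝ) * (2 ^ n * 2 ^ n) * ?_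
          exact pow_le_pow_of_le_one (by positivity) hb1 hk6
      _ = (2 * 8 ^ 6 * (ℓ : ℝ) * (m + 1) ^ 6) / (2 ^ n) ^ 4 := by
          rw [hbdef]
          field_simp
      _ ≤ 2 ^ n / (2 ^ n) ^ 4 := by gcongr
      _ = 1 / 2 ^ (3 * n) := by
          rw [mul_comm 3 n, pow_mul]
          field_simp
  calc 2 ^ n * (ℓ * 2 ^ n * (2 ^ ℓ * (s ^ 8 + 1 / 2 ^ n + m / 2 ^ n) ^ (ℓ / 2)))
      ≤ 2 ^ n * (ℓ * 2 ^ n * (2 * 4 ^ k * (2 ^ k * ((s ^ 8) ^ k + b ^ k)))) := by gcongr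
    _ = 2 * ℓ * (2 ^ n * 2 ^ n) * (8 * s ^ 8) ^ k + 2 * ℓ * (2 ^ n * 2 ^ n) * (8 * b) ^ k := by
        rw [mul_pow, mul_pow, show (8 : ℝ) ^ k = 4 ^ k * 2 ^ k by rw [← mul_pow]; norm_num]
        ring
    _ ≤ 2 * ℓ * (4 * 16 ^ k) * (8 * s ^ 8) ^ k + 1 / 2 ^ (3 * n) := by
        refine add_le_add ?_ t2
        gcongr
    _ = 8 * ℓ * (128 * s ^ 8) ^ k + 1 / 2 ^ (3 * n) := by
        rw [mul_pow, mul_pow, show (128 : ℝ) ^ k = 16 ^ k * 8 ^ k by rw [← mul_pow]; norm_num]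
        ring
    _ ≤ _ := by gcongr

theorem Subversion.DisagreementAtMost.nonneg {Ht : Subversion n ℓ} {ε : ℝ}
    (hε : Ht.DisagreementAtMost ε) : 0 ≤ ε :=
  (uniformProb_nonneg _).trans (hε (Classical.arbitrary _)).1

theorem OracleAlg.QueryBound.run_eq {Q : Type} {A : Q → Type} {α : Type} {M : OracleAlg Q A α}
    (hM : M.QueryBound 0) (O O' : (q : Q) → A q) : M.run O' = M.run O := by
  refine (OracleAlg.run_queries_congr M fun q hq => ?_).1
  have := List.eq_nil_of_length_eq_zero (Nat.le_zero.1 (hM O))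
  rw [this] at hq
  cases hq

/-- Without queries the subverted functions are constant in `h`, so some family differs from them at
every point. Positivity of `m` matters because the final bound has it as a factor. -/
theorem Subversion.DisagreementAtMost.queryBound_pos {Ht : Subversion n ℓ} {ε : ℝ} {m : ℕ}
    (hε : Ht.DisagreementAtMost ε) (hε1 : ε < 1) (hn : 0 < n) (hℓ : 0 < ℓ)
    (hm : ∀ p, (Ht p).QueryBound m) : 1 ≤ m := by
  rw [Nat.one_le_iff_ne_zero]
  rintro rfl
  let h₀ : HashFamily n ℓ := Classical.arbitrary _
  let h : HashFamily n ℓ := fun p =>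
    match p with
    | .inl y => h₀ (.inl y)
    | .inr q => ((Ht (.inr q)).run h₀ : Bits (3 * n)) + 1
  have hne : ∀ q, (Ht (.inr q)).run h ≠ h (.inr q) := by
    intro q e
    rw [(hm (.inr q)).run_eq h₀ h] at e
    have := congrFun e ⟨0, by omega⟩
    simp [h] at this
  have h1 := (hε h).2 ⟨0, hℓ⟩
  simp only [hne, ne_eq, not_false_eq_true, uniformProb, Finset.filter_true,
    Finset.card_univ] at h1
  rw [div_self (by exact_mod_cast Fintype.card_ne_zero)] at h1
  linarith

theorem predProb_eq_zero {U : Type} [Fintype U] {Ht : Subversion n ℓ} {D : U → Distinguisher n ℓ}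
    {m : ℕ} (hm : ∀ p, (Ht p).QueryBound m) (hd : ∀ u R, (D u R).QueryBound 0) :
    predProb U Ht D = 0 := by
  have : ∀ ω : U × (Fin ℓ → Bits n) × HashFamily n ℓ, ¬ Pred Ht (D ω.1) ω.2.1 ω.2.2 := by
    intro ω hω
    obtain ⟨t, -⟩ := hω.exists_hit hm (hd _ _)
    exact t.elim0
  simp [predProb, uniformProb, this]

theorem predProb_le_of_small {U : Type} [Fintype U] [Nonempty U] {Ht : Subversion n ℓ}
    {D : U → Distinguisher n ℓ} {m d : ℕ} {ε : ℝ} (hn : 8 ≤ n) (hℓ : n + 4 < ℓ)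
    (hP : ((1024 * ((ℓ : ℝ) + 1) ^ 2 * (m + 1)) ^ 16) * ε ≤ 1)
    (hb : 2 * 8 ^ 6 * (ℓ : ℝ) * (m + 1) ^ 6 ≤ 2 ^ n)
    (hm : ∀ p, (Ht p).QueryBound m) (hε : Ht.DisagreementAtMost ε)
    (hd : ∀ u R, (D u R).QueryBound d) :
    predProb U Ht D ≤ 9 * ((ℓ : ℝ) ^ 2 * (d : ℝ) ^ 2 * (m : ℝ) * (2 : ℝ) ^ (-(3 * (n : ℝ)))
      + Real.sqrt (ℓ : ℝ) * (d : ℝ) * ε ^ ((1 : ℝ) / 16)) := by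
  have hε0 := hε.nonneg
  obtain ⟨s, hs⟩ : ∃ s, s = ε ^ ((1 : ℝ) / 16) := ⟨_, rfl⟩
  have hs0 : 0 ≤ s := hs ▸ Real.rpow_nonneg hε0 _
  have hsε : ε = s ^ 16 := by
    rw [hs, ← Real.rpow_natCast, ← Real.rpow_mul hε0]
    norm_num
  rw [← hs]
  have h3n : (2 : ℝ) ^ (-(3 * (n : ℝ))) = 1 / 2 ^ (3 * n) := by
    rw [Real.rpow_neg (by norm_num), one_div, ← Real.rpow_natCast]
    push_cast
    rfl
  rw [h3n]
  rcases Nat.eq_zero_or_pos d with rfl | hd1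
  · rw [predProb_eq_zero hm hd]
    positivity
  have hℓ1 : (1 : ℝ) ≤ ℓ := by exact_mod_cast (by omega : 1 ≤ ℓ)
  have hd1' : (1 : ℝ) ≤ d := by exact_mod_cast hd1
  have hm0 : (0 : ℝ) ≤ m := Nat.cast_nonneg m
  have hPs : 1024 * ((ℓ : ℝ) + 1) ^ 2 * (m + 1) * s ≤ 1 := by
    generalize hQ : 1024 * ((ℓ : ℝ) + 1) ^ 2 * (m + 1) = Q at hP ⊢
    have hQ0 : 0 ≤ Q := by
      rw [← hQ]
      positivity
    rw [hsε, ← mul_pow] at hP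
    exact (pow_le_one_iff_of_nonneg (mul_nonneg hQ0 hs0) (by norm_num)).1 hP
  clear hP
  have hℓs : 1024 * (ℓ : ℝ) * s ≤ 1 := by
    refine le_trans (mul_le_mul_of_nonneg_right ?_ hs0) hPs
    have : (ℓ : ℝ) ≤ ((ℓ : ℝ) + 1) ^ 2 := by nlinarith
    have h0 : (0 : ℝ) ≤ 1024 * ((ℓ : ℝ) + 1) ^ 2 * m := by positivity
    nlinarith
  have hℓms : 6 * (ℓ : ℝ) ^ 2 * m * s ≤ 1 := by
    refine le_trans ?_ hPs
    gcongr <;> linarith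
  have hs1024 : 1024 * s ≤ 1 := by nlinarith
  have hs1 : s ≤ 1 := by linarith
  have hε1 : ε < 1 := by
    rw [hsε]
    exact pow_lt_one₀ hs0 (by linarith) (by norm_num)
  have hm1 : 1 ≤ m := hε.queryBound_pos hε1 (by omega) (by omega) hm
  have hm1' : (1 : ℝ) ≤ m := by exact_mod_cast hm1
  have hη1 : s ^ 8 + 1 / 2 ^ n + m / 2 ^ n ≤ (1 : ℝ) := by
    have h1 : s ^ 8 ≤ s := pow_le_of_le_one hs0 hs1 (by norm_num)
    have h2 : (1 / 2 ^ n + m / 2 ^ n : ℝ) ≤ 1 / 2 := by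
      rw [← add_div, div_le_div_iff₀ (by positivity) (by norm_num)]
      have h6 : (m + 1 : ℝ) ≤ (m + 1) ^ 6 := le_self_pow₀ (by linarith) (by norm_num)
      have : (m + 1 : ℝ) ^ 6 ≤ ℓ * (m + 1) ^ 6 := le_mul_of_one_le_left (by positivity) hℓ1
      linarith
    linarith
  -- The threshold ε^(1/2) + 2^(-n) makes both the Markov term and the atypical term at most of
  -- order ε^(1/16) + 2^(-3n).
  have main := predProb_le (by omega) hm hε hd (η := s ^ 8 + 1 / 2 ^ n) (by positivity) hη1
  have m1 := markov_term_le (ℓ := ℓ) (m := m) (u := 1 / 2 ^ n) hs0 (by positivity) hs1 (by omega)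
    hm1 hℓms
  have m2 := atypical_term_le (m := m) hs0 hs1 hn hℓ hℓs hb
  rw [← hsε] at m1
  have hN : (0 : ℝ) < 1 / 2 ^ (3 * n) := by positivity
  have hℓm : (ℓ : ℝ) * m + 1 ≤ 2 * ((ℓ : ℝ) ^ 2 * m) := by
    have h1 : (1 : ℝ) ≤ ℓ * m := one_le_mul_of_one_le_of_one_le hℓ1 hm1'
    have h2 : (ℓ : ℝ) * m ≤ ℓ ^ 2 * m := by
      gcongr
      exact le_self_pow₀ hℓ1 (by norm_num)
    linarith
  have m3 : (d : ℝ) * (d * ((ℓ * m + 1) * (4 / 2 ^ (3 * n)))) ≤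
      8 * ((ℓ : ℝ) ^ 2 * (d : ℝ) ^ 2 * m * (1 / 2 ^ (3 * n))) := by
    calc (d : ℝ) * (d * ((ℓ * m + 1) * (4 / 2 ^ (3 * n))))
        = (d : ℝ) ^ 2 * 4 * (1 / 2 ^ (3 * n)) * (ℓ * m + 1) := by ring
      _ ≤ (d : ℝ) ^ 2 * 4 * (1 / 2 ^ (3 * n)) * (2 * ((ℓ : ℝ) ^ 2 * m)) := by gcongr
      _ = _ := by ring
  have m4 : 1 / 2 ^ (3 * n) ≤ (ℓ : ℝ) ^ 2 * (d : ℝ) ^ 2 * m * (1 / 2 ^ (3 * n)) :=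
    le_mul_of_one_le_left hN.le (one_le_mul_of_one_le_of_one_le
      (one_le_mul_of_one_le_of_one_le (one_le_pow₀ hℓ1) (one_le_pow₀ hd1')) hm1')
  have m5 : s ≤ Real.sqrt ℓ * d * s :=
    le_mul_of_one_le_left hs0 (one_le_mul_of_one_le_of_one_le (Real.one_le_sqrt.2 hℓ1) hd1')
  -- The first term of the bound is used 8 + 1 times (`m3`, `m4`) and the second twice, whence the
  -- constant 9.
  linarith

theorem eventually_polynomial_mul_le_one {f : ℕ → ℝ}
    (hf : Asymptotics.SuperpolynomialDecay Filter.atTop (fun n : ℕ => (n : ℝ)) f)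
    (p : Polynomial ℕ) : ∀ᶠ n in Filter.atTop, ((p.eval n : ℕ) : ℝ) * f n ≤ 1 := by
  have h := hf.polynomial_mul (p.map (Nat.castRingHom ℝ)) 0
  simp only [pow_zero, one_mul] at h
  filter_upwards [h.eventually (eventually_le_nhds one_pos)] with n hn
  simpa [Polynomial.eval_natCast_map] using hn

theorem superpolynomialDecay_inv_two_pow :
    Asymptotics.SuperpolynomialDecay Filter.atTop (fun n : ℕ => (n : ℝ))
      (fun n => (1 / 2 : ℝ) ^ n) := fun k =>
  tendsto_pow_const_mul_const_pow_of_abs_lt_one k (by norm_num [abs_of_pos])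

end Crooked

theorem mainTheorem4 :
    ∃ C : ℝ, 0 < C ∧
      ∀ (ℓ qD qH : ℕ → ℕ) (ε : ℕ → ℝ),
        (∀ n, n + 4 < ℓ n) →
        Crooked.PolyBounded ℓ → Crooked.PolyBounded qD → Crooked.PolyBounded qH →
        Asymptotics.SuperpolynomialDecay Filter.atTop (fun n : ℕ => (n : ℝ)) ε →
        ∀ᶠ n in Filter.atTop,
          ∀ (Ht : Crooked.Subversion n (ℓ n)) (U : Type) [Fintype U] [Nonempty U]
            (D : U → Crooked.Distinguisher n (ℓ n)),
            (∀ p, (Ht p).QueryBound (qH n)) →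
            Ht.DisagreementAtMost (ε n) →
            (∀ u R, (D u R).QueryBound (qD n)) →
            Crooked.predProb U Ht D ≤
              C * ((ℓ n : ℝ) ^ 2 * (qD n : ℝ) ^ 2 * (qH n : ℝ) * (2 : ℝ) ^ (-(3 * (n : ℝ)))
                + Real.sqrt (ℓ n : ℝ) * (qD n : ℝ) * (ε n) ^ ((1 : ℝ) / 16)) := by
  refine ⟨9, by norm_num, ?_⟩
  rintro ℓ qD qH ε hℓ ⟨pℓ, hpℓ⟩ - ⟨pm, hpm⟩ hε
  -- The 16th power lets decay of ε itself control a polynomial times ε^(1/16).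
  have e1 := Crooked.eventually_polynomial_mul_le_one hε
    ((1024 * (pℓ + 1) ^ 2 * (pm + 1)) ^ 16)
  have e2 := Crooked.eventually_polynomial_mul_le_one Crooked.superpolynomialDecay_inv_two_pow
    (2 * 8 ^ 6 * pℓ * (pm + 1) ^ 6)
  filter_upwards [e1, e2, Filter.eventually_ge_atTop 8] with n h1 h2 hn
  intro Ht U _ _ D hm hdis hd
  have hε0 := hdis.nonneg
  have cℓ : (ℓ n : ℝ) ≤ (pℓ.eval n : ℕ) := by exact_mod_cast hpℓ n
  have cm : (qH n : ℝ) ≤ (pm.eval n : ℕ) := by exact_mod_cast hpm n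
  refine Crooked.predProb_le_of_small hn (hℓ n) (le_trans ?_ h1) ?_ hm hdis hd
  · simp only [Polynomial.eval_pow, Polynomial.eval_mul, Polynomial.eval_add, Polynomial.eval_one,
      Polynomial.eval_ofNat]
    push_cast
    gcongr
  · simp only [Polynomial.eval_pow, Polynomial.eval_mul, Polynomial.eval_add, Polynomial.eval_one,
      Polynomial.eval_ofNat] at h2
    rw [one_div, inv_pow, ← div_eq_mul_inv, div_le_one (by positivity)] at h2
    refine le_trans ?_ h2
    push_cast
    gcongr
    norm_num
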